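/- Let $n,d\ge 1$, let $M\in\mathbb R^{d\times d}$ be symmetric positive definite, let $a_1,\dots,a_n\ge 0$ be integers and $p_1,\dots,p_n$ real numbers with $$\gamma_i:=a_i-2p_i>-d\quad(i=1,\dots,n),\qquad \gamma_{\min}:=\min_i\gamma_i,\qquad r:=d+\gamma_{\min}>0 .$$ Let $V=[-\tfrac12,\tfrac12]^d$. Let $f_1,\dots,f_n$ be smooth (real- or complex-valued) functions of $x=(x_1,\dots,x_n)\in\mathbb R^d\times\cdots\times\mathbb R^d$ such that, for each $i$, $f_i$ is analytic and satisfies $f_i(x)=\mathcal O(|x_i|^{a_i})$ near every point of $V^{n}$ with $x_i=0$. Define, where all $x_i\neq 0$, $$g(x_1,\dots,x_n)=\prod_{i=1}^n\frac{f_i(x_1,\dots,x_n)}{(x_i^{T}Mx_i)^{p_i}} .$$ For $m\ge 1$ and a fixed relative offset $x_*\in[0,1]^{nd}$, the $m^{nd}$-sized uniform mesh $\mathcal X$ in $V^{n}=[-\frac12,\frac12]^{nd}$ consists of the nodes with coordinates $-\frac12+\frac{1}{m}(j_l+x_{*,l})$, $j_l\in\{0,\dots,m-1\}$, $l=1,\dots,nd$.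 Let $$\mathcal E_m=\int_{V^{n}}g\,dx_1\cdots dx_n-\frac1{m^{nd}}\sum_{x\in\mathcal X}g(x)$$ be the error of the trapezoidal rule, where $g(x)$ is set to $0$ at the nodes with some $x_i=0$. For an $nd$-dimensional multi-index $\beta$ let $$c_\beta(x_*)=-\prod_{l=1}^{nd}\frac{B_{\beta_l}(x_{*,l})}{\beta_l!},$$ with $B_k$ the Bernoulli polynomials, and let $g^{(\beta)}$ be the classical partial derivative of $g$ (defined where all $x_i\ne0$, i.e. almost everywhere). Then $g^{(\beta)}$ is integrable on $V^{n}$ for all $|\beta|<r$, and $$\mathcal E_m=\sum_{1\le s<r}\frac1{m^s}\sum_{|\beta|=s}c_\beta(x_*)\int_{V^{n}}g^{(\beta)}\,dx_1\cdots dx_n+\mathcal O\!\left(\frac{\ln m}{m^{r}}\right)\qquad(m\to\infty),$$ where $s$ runs over integers (so $s=1,\dots,d+\gamma_{\min}-1$ if $\gamma_{\min}$ is an integer). Moreover, the remainder constant is controlled by bounds on the derivatives of the $f_i$: for every $K$ there is a constant $C$, depending only on $K,n,d,M,(a_i),(p_i),x_*$ and the scalar field ($\mathbb R$ or $\mathbb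 C$), such that the remainder is at most $C\,m^{-r}\ln m$ in absolute value for all $m\ge2$ and all $f_1,\dots,f_n$ as above for which, for each $i$ and all $x\in V^{n}$, $|\partial^\alpha f_i(x)|\le K|x_i|^{a_i-|\alpha|}$ whenever $|\alpha|\le a_i$, and $|\partial^\alpha f_i(x)|\le K$ whenever $a_i<|\alpha|\le\lceil r\rceil$. Here $\alpha$ runs over $nd$-dimensional multi-indices. -/

import Mathlib

open MeasureTheory Filter Topology Asymptotics
open scoped ContDiff Matrix

namespace FracEM

/-- Points `(x₁, …, xₙ)` of `ℝᵈ × ⋯ × ℝᵈ`; each block carries the Euclidean norm. -/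
abbrev Pt (n d : ℕ) : Type := Fin n → EuclideanSpace ℝ (Fin d)

/-- Multi-indices of dimension `n d`; the entry `β (i, k)` belongs to the `k`-th coordinate
of the block `xᵢ`. -/
abbrev MultiIndex (n d : ℕ) : Type := Fin n × Fin d → ℕ

/-- The order `|β|` of a multi-index. -/
def order {n d : ℕ} (β : MultiIndex n d) : ℕ := ∑ l, β l

/-- The unit vector of the `k`-th coordinate of the block `xᵢ`. -/
noncomputable def unitVec {n d : ℕ} (l : Fin n × Fin d) : Pt n d :=
  Pi.single l.1 (EuclideanSpace.single l.2 (1 : ℝ))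

/-- The domain `V × ⋯ × V` with `V = [-1/2, 1/2]ᵈ`. -/
def cube (n d : ℕ) : Set (Pt n d) :=
  {x | ∀ i k, x i k ∈ Set.Icc (-(1 / 2) : ℝ) (1 / 2)}

section

variable {𝕜 : Type*} [RCLike 𝕜] {n d : ℕ}

/-- The classical first-order partial derivative in one of the `n d` coordinates. -/
noncomputable def partialDeriv (l : Fin n × Fin d) (h : Pt n d → 𝕜) : Pt n d → 𝕜 :=
  fun x => fderiv ℝ h x (unitVec l)

/-- The classical partial derivative `∂^β h`, one coordinate after the other. (On an open set
where `h` is smooth the order of the differentiations is immaterial.) -/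
noncomputable def multiDeriv (β : MultiIndex n d) (h : Pt n d → 𝕜) : Pt n d → 𝕜 :=
  (List.finRange n).foldr (fun i h₁ =>
    (List.finRange d).foldr (fun k h₂ => (partialDeriv (i, k))^[β (i, k)] h₂) h₁) h

/-- The fractional form `g = ∏ᵢ fᵢ(x₁, …, xₙ) / (xᵢᵀ M xᵢ)^(pᵢ)`. -/
noncomputable def fractionalForm (M : Matrix (Fin d) (Fin d) ℝ) (p : Fin n → ℝ)
    (f : Fin n → Pt n d → 𝕜) : Pt n d → 𝕜 :=
  fun x => ∏ i, f i x / (((x i).ofLp ⬝ᵥ (M *ᵥ (x i).ofLp)) ^ (p i) : ℝ)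

/-- The node of the `m^(nd)`-sized uniform mesh in `cube n d` with relative offset `xs` that lies
in the cell with index `j`. -/
noncomputable def node (xs : Fin n × Fin d → ℝ) (m : ℕ) (j : Fin n × Fin d → Fin m) : Pt n d :=
  fun i => WithLp.toLp 2 fun k => -(1 / 2 : ℝ) + (((j (i, k) : ℕ) : ℝ) + xs (i, k)) / m

open scoped Classical in
/-- The trapezoidal rule for `g` on the `m^(nd)`-sized uniform mesh with relative offset `xs`, where
`g` is replaced by `0` at the nodes with some `xᵢ = 0`. The volume of `cube n d` is `1`. -/
noncomputable def trapezoidal (g : Pt n d → 𝕜) (xs : Fin n × Fin d → ℝ) (m : ℕ) : 𝕜 :=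
  ((m : 𝕜) ^ (n * d))⁻¹ * ∑ j : Fin n × Fin d → Fin m,
    if ∃ i, node xs m j i = 0 then 0 else g (node xs m j)

/-- The quadrature error: integral minus trapezoidal rule. -/
noncomputable def quadError (g : Pt n d → 𝕜) (xs : Fin n × Fin d → ℝ) (m : ℕ) : 𝕜 :=
  (∫ x in cube n d, g x) - trapezoidal g xs m

/-- The coefficient `c_β(x) = - ∏ B_{β_l}(x_l) / β_l!`, with the Bernoulli polynomials `B_k`. -/
noncomputable def emCoeff (β : MultiIndex n d) (xs : Fin n × Fin d → ℝ) : ℝ :=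
  -∏ l, bernoulliFun (β l) (xs l) / ((β l).factorial : ℝ)

/-- The exponent `γᵢ = aᵢ - 2 pᵢ`. -/
def gam (a : Fin n → ℕ) (p : Fin n → ℝ) (i : Fin n) : ℝ := (a i : ℝ) - 2 * p i

/-- The exponent `d + γ_min`, where `γ_min = minᵢ γᵢ`. -/
noncomputable def rate (d : ℕ) (a : Fin n → ℕ) (p : Fin n → ℝ) : ℝ :=
  (d : ℝ) + ⨅ i, gam a p i

/-- The Euler-Maclaurin terms `∑ₛ m⁻ˢ ∑_{|β| = s} c_β(xs) ∫ g^(β)` over all integers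
`1 ≤ s < r`. For an integer `r` this is the range `s = 1, …, r - 1`. -/
noncomputable def emSum (g : Pt n d → 𝕜) (xs : Fin n × Fin d → ℝ) (r : ℝ) (m : ℕ) : 𝕜 :=
  ∑ s ∈ Finset.Ico 1 ⌈r⌉₊, ((m : 𝕜) ^ s)⁻¹ *
    ∑ β ∈ Finset.piAntidiag (Finset.univ : Finset (Fin n × Fin d)) s,
      (emCoeff β xs : 𝕜) * ∫ x in cube n d, multiDeriv β g x

/-- The assumptions on the numerators: each `fᵢ` is smooth, and at every point of the domain with
`xᵢ = 0` it is analytic and `O(|xᵢ|^(aᵢ))`. -/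
structure Admissible (a : Fin n → ℕ) (f : Fin n → Pt n d → 𝕜) : Prop where
  smooth : ∀ i, ContDiff ℝ ∞ (f i)
  analytic : ∀ i, ∀ y ∈ cube n d, y i = 0 → AnalyticAt ℝ (f i) y
  isBigO : ∀ i, ∀ y ∈ cube n d, y i = 0 → f i =O[𝓝 y] fun x => ‖x i‖ ^ a i

/-- `K` is an upper bound on the domain of all the functions `|∂^α fᵢ| / |xᵢ|^(aᵢ - |α|)` with
`|α| ≤ aᵢ`, and of all `|∂^α fᵢ|` with `aᵢ < |α| ≤ ⌈r⌉`. -/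
structure DerivBound (a : Fin n → ℕ) (r : ℝ) (f : Fin n → Pt n d → 𝕜) (K : ℝ) : Prop where
  low : ∀ i, ∀ α : MultiIndex n d, order α ≤ a i →
    ∀ x ∈ cube n d, ‖multiDeriv α (f i) x‖ ≤ K * ‖x i‖ ^ (a i - order α)
  high : ∀ i, ∀ α : MultiIndex n d, a i < order α → order α ≤ ⌈r⌉₊ →
    ∀ x ∈ cube n d, ‖multiDeriv α (f i) x‖ ≤ K

end

end FracEM

/-!
The expansion is obtained cell by cell. On a mesh cell `Q` of side length `h = 1 / m` that avoids
the singular set, let `F_R(u)(x)` be the remainder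
`u(x) - ∑_{|β| < R} h^|β| (∏ B_{β_l}(t_l) / β_l!) ⨍_Q ∂^β u` of the one-node rule, as a function
of the position `x` of the node, where `t` is the position of `x` relative to `Q`. Since the
Bernoulli polynomials form an Appell sequence, `∂_l F_{R+1}(u) = F_R(∂_l u)`, and `F_{R+1}(u)` has
mean zero over `Q` because `B_k` has mean zero on `[0, 1]` for `k ≥ 1`. Induction on `R` yields
`|F_R(u)| ≤ (n d h)^R sup |∂^R u|` (`norm_cellRemainder_le`); no Taylor expansion is needed.

With `σ = ∑ᵢ |xᵢ|⁻¹`, the derivatives of `g` satisfy `|∂^β g| ≤ C ∏ᵢ |xᵢ|^(γᵢ) σ^|β|`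
(`exists_multiDeriv_fractionalForm_le`): each derivative costs a factor `σ`, for the numerators by
`DerivBound.symbolBound` and for the powers of the quadratic forms by homogeneity, and bounds of
this shape are stable under products (`SymbolBound.mul`). As `|β| < r ≤ d + γᵢ` for all `i`, this
gives the integrability of `∂^β g`.

For a cell whose `i`-th block has distance about `ρᵢ ≥ h` from `0`, both estimates lead to an
error of at most `C h^(nd) ∏ₖ ρₖ^(γₖ) ∑ᵢ (h / ρᵢ)^r` (`exists_norm_cellError_le`): away from the
singular set by the one-node formula of order `⌈r⌉`, and close to it, where some `h / ρᵢ` is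
bounded below, because every single term of the expansion is that small. There the fixed offset
enters: the nodes with `xᵢ ≠ 0` have `|xᵢ| ≥ c h`. The sum of these bounds over all cells
factorizes over the blocks. A block with exponent `γₖ > -d` contributes a bounded factor, and the
one that carries `(h / ρᵢ)^r` contributes `O(h^r ln m)`, since `γᵢ - r ≥ -d` and `h^d ∑ ρ^(-d)` is
at most a constant times a harmonic sum (`exists_sum_cellWeight_mul_cellDecay_le`).

All constants depend on the numerators through a constant in `DerivBound` only. Such a constant
exists for admissible numerators (`Admissible.exists_derivBound`): by a Landau-Kolmogorov
inequality on segments of length about `|xᵢ|`, a smooth function that is `O(|xᵢ|^(a+1))` has first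
derivatives that are `O(|xᵢ|^a)`, and compactness of the cube makes the local bounds uniform.
-/

namespace FracEM

/-! ### Calculus of mixed partial derivatives -/

section PartialDerivatives

variable {𝕜 : Type*} [RCLike 𝕜] {n d : ℕ} {U : Set (Pt n d)} {u v : Pt n d → 𝕜}

theorem partialDeriv_congr (hU : IsOpen U) (h : Set.EqOn u v U) (l : Fin n × Fin d) :
    Set.EqOn (partialDeriv l u) (partialDeriv l v) U := by
  intro x hx
  have : u =ᶠ[𝓝 x] v := by
    filter_upwards [hU.mem_nhds hx] with y hy using h hy
  simp only [partialDeriv, this.fderiv_eq]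

theorem contDiffOn_partialDeriv (hU : IsOpen U) (hu : ContDiffOn ℝ ∞ u U) (l : Fin n × Fin d) :
    ContDiffOn ℝ ∞ (partialDeriv l u) U := by
  have h := hu.fderiv_of_isOpen (m := ∞) hU (by simp)
  exact h.clm_apply contDiffOn_const

theorem partialDeriv_comm (hU : IsOpen U) (hu : ContDiffOn ℝ ∞ u U) (l k : Fin n × Fin d) :
    Set.EqOn (partialDeriv l (partialDeriv k u)) (partialDeriv k (partialDeriv l u)) U := by
  intro x hx
  have hu' : ContDiffAt ℝ ∞ u x := hu.contDiffAt (hU.mem_nhds hx)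
  have hu2 : ContDiffAt ℝ 2 u x := 
    hu'.of_le (WithTop.coe_le_coe.2 (le_top : (2 : ℕ∞) ≤ ⊤))
  have hs : IsSymmSndFDerivAt ℝ u x := hu2.isSymmSndFDerivAt (by simp)
  have hd : DifferentiableAt ℝ (fderiv ℝ u) x :=
    (hu2.fderiv_right (m := 1) (by norm_num)).differentiableAt (by simp)
  have key : ∀ l k : Fin n × Fin d, partialDeriv l (partialDeriv k u) x
      = fderiv ℝ (fderiv ℝ u) x (unitVec l) (unitVec k) := by
    intro l k
    have h : HasFDerivAt (partialDeriv k u) ((fderiv ℝ (fderiv ℝ u) x).flip (unitVec k)) x := by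
      have h := hd.hasFDerivAt.clm_apply (hasFDerivAt_const (unitVec k : Pt n d) x)
      simp only [ContinuousLinearMap.comp_zero, zero_add] at h
      exact h
    change fderiv ℝ (partialDeriv k u) x (unitVec l) = _
    rw [h.fderiv]
    rfl
  rw [key, key]
  exact hs _ _

theorem partialDeriv_iterate_congr (hU : IsOpen U) (h : Set.EqOn u v U) (l : Fin n × Fin d)
    (k : ℕ) : Set.EqOn ((partialDeriv l)^[k] u) ((partialDeriv l)^[k] v) U := by
  induction k with
  | zero => simpa using h
  | succ k ih =>
    simp only [Function.iterate_succ_apply']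
    exact partialDeriv_congr hU ih l

theorem contDiffOn_partialDeriv_iterate (hU : IsOpen U) (hu : ContDiffOn ℝ ∞ u U)
    (l : Fin n × Fin d) (k : ℕ) : ContDiffOn ℝ ∞ ((partialDeriv l)^[k] u) U := by
  induction k with
  | zero => simpa using hu
  | succ k ih =>
    simp only [Function.iterate_succ_apply']
    exact contDiffOn_partialDeriv hU ih l

theorem partialDeriv_iterate_comm (hU : IsOpen U) (hu : ContDiffOn ℝ ∞ u U)
    (l l' : Fin n × Fin d) (k : ℕ) :
    Set.EqOn (partialDeriv l ((partialDeriv l')^[k] u))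
      ((partialDeriv l')^[k] (partialDeriv l u)) U := by
  induction k with
  | zero => simpa using Set.eqOn_refl _ _
  | succ k ih =>
    simp only [Function.iterate_succ_apply']
    exact (partialDeriv_comm hU (contDiffOn_partialDeriv_iterate hU hu l' k) l l').trans
      (partialDeriv_congr hU ih l')

/-- The mixed partial derivative along a list of coordinates, with the multiplicities given
by `β`. -/
noncomputable def listDeriv (L : List (Fin n × Fin d)) (β : MultiIndex n d) (u : Pt n d → 𝕜) :
    Pt n d → 𝕜 :=
  L.foldr (fun l h => (partialDeriv l)^[β l] h) u

theorem contDiffOn_listDeriv (hU : IsOpen U) (hu : ContDiffOn ℝ ∞ u U)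
    (L : List (Fin n × Fin d)) (β : MultiIndex n d) : ContDiffOn ℝ ∞ (listDeriv L β u) U := by
  induction L with
  | nil => simpa [listDeriv] using hu
  | cons l L ih => exact contDiffOn_partialDeriv_iterate hU ih l _

theorem partialDeriv_listDeriv (hU : IsOpen U) (hu : ContDiffOn ℝ ∞ u U)
    (L : List (Fin n × Fin d)) (β : MultiIndex n d) (l : Fin n × Fin d) :
    Set.EqOn (partialDeriv l (listDeriv L β u)) (listDeriv L β (partialDeriv l u)) U := by
  induction L with
  | nil => simpa [listDeriv] using Set.eqOn_refl _ _
  | cons l' L ih =>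
    exact (partialDeriv_iterate_comm hU (contDiffOn_listDeriv hU hu L β) l l' _).trans
      (partialDeriv_iterate_congr hU ih l' _)

theorem listDeriv_add_single_of_notMem (L : List (Fin n × Fin d)) (β : MultiIndex n d)
    {l : Fin n × Fin d} (hl : l ∉ L) : listDeriv L (β + Pi.single l 1) u = listDeriv L β u := by
  induction L with
  | nil => rfl
  | cons l' L ih =>
    simp only [List.mem_cons, not_or] at hl
    have h1 := ih hl.2
    simp only [listDeriv, List.foldr_cons] at h1 ⊢
    rw [h1]
    simp [Ne.symm hl.1]

theorem listDeriv_add_single (hU : IsOpen U) (hu : ContDiffOn ℝ ∞ u U)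
    (L : List (Fin n × Fin d)) (hL : L.Nodup) (β : MultiIndex n d) {l : Fin n × Fin d}
    (hl : l ∈ L) :
    Set.EqOn (listDeriv L (β + Pi.single l 1) u) (listDeriv L β (partialDeriv l u)) U := by
  induction L with
  | nil => simp at hl
  | cons l' L ih =>
    rw [List.nodup_cons] at hL
    by_cases h : l = l'
    · subst h
      have h1 := listDeriv_add_single_of_notMem (u := u) L β hL.1
      have h2 : listDeriv (l :: L) (β + Pi.single l 1) u
          = (partialDeriv l)^[β l] (partialDeriv l (listDeriv L β u)) := by
        rw [← h1]
        simp [listDeriv, Function.iterate_succ_apply]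
      rw [h2]
      exact partialDeriv_iterate_congr hU (partialDeriv_listDeriv hU hu L β l) l _
    · have h1 := ih hL.2 ((List.mem_cons.1 hl).resolve_left h)
      have h2 : listDeriv (l' :: L) (β + Pi.single l 1) u
          = (partialDeriv l')^[β l'] (listDeriv L (β + Pi.single l 1) u) := by
        simp [listDeriv, Pi.single_apply, Ne.symm h]
      rw [h2]
      exact partialDeriv_iterate_congr hU h1 l' _

/-- All coordinates, in the order in which `multiDeriv` runs through them. -/
def coordList (n d : ℕ) : List (Fin n × Fin d) :=
  (List.finRange n).flatMap fun i => (List.finRange d).map fun k => (i, k)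

theorem coordList_nodup : (coordList n d).Nodup := by
  rw [show coordList n d = (List.finRange n) ×ˢ (List.finRange d) from rfl]
  exact (List.nodup_finRange n).product (List.nodup_finRange d)

theorem mem_coordList (l : Fin n × Fin d) : l ∈ coordList n d := by
  simp [coordList]

theorem multiDeriv_eq_listDeriv (β : MultiIndex n d) (u : Pt n d → 𝕜) :
    multiDeriv β u = listDeriv (coordList n d) β u := by
  simp only [multiDeriv, listDeriv, coordList]
  induction List.finRange n with
  | nil => rfl
  | cons i L ih => simp [List.foldr_append, List.foldr_map, ih]

theorem contDiffOn_multiDeriv (hU : IsOpen U) (hu : ContDiffOn ℝ ∞ u U) (β : MultiIndex n d) :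
    ContDiffOn ℝ ∞ (multiDeriv β u) U := by
  simpa only [multiDeriv_eq_listDeriv] using contDiffOn_listDeriv hU hu _ β

theorem multiDeriv_zero (u : Pt n d → 𝕜) : multiDeriv 0 u = u := by
  rw [multiDeriv_eq_listDeriv, listDeriv]
  induction coordList n d with
  | nil => rfl
  | cons l L ih => simp

theorem multiDeriv_add_single (hU : IsOpen U) (hu : ContDiffOn ℝ ∞ u U) (β : MultiIndex n d)
    (l : Fin n × Fin d) :
    Set.EqOn (multiDeriv (β + Pi.single l 1) u) (multiDeriv β (partialDeriv l u)) U := by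
  simpa only [multiDeriv_eq_listDeriv] using
    listDeriv_add_single hU hu _ coordList_nodup β (mem_coordList l)

theorem order_add_single (β : MultiIndex n d) (l : Fin n × Fin d) :
    order (β + Pi.single l 1) = order β + 1 := by
  simp [order, Finset.sum_add_distrib]

theorem eq_zero_of_order_eq_zero {β : MultiIndex n d} (h : order β = 0) : β = 0 := by
  funext l
  simpa using (Finset.sum_eq_zero_iff.1 h) l (Finset.mem_univ l)

theorem sub_single_add_single {β : MultiIndex n d} {l : Fin n × Fin d} (hl : β l ≠ 0) :
    β - Pi.single l 1 + Pi.single l 1 = β := by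
  funext k
  by_cases hk : k = l
  · subst hk; simp; omega
  · simp [hk]

theorem exists_eq_add_single {β : MultiIndex n d} {s : ℕ} (h : order β = s + 1) :
    ∃ (β' : MultiIndex n d) (l : Fin n × Fin d), order β' = s ∧ β = β' + Pi.single l 1 := by
  have : ∃ l, β l ≠ 0 := by
    by_contra! h0
    simp [order, h0] at h
  obtain ⟨l, hl⟩ := this
  have h1 := (sub_single_add_single hl).symm
  refine ⟨β - Pi.single l 1, l, ?_, h1⟩
  rw [h1, order_add_single] at h
  omega

end PartialDerivatives

/-! ### Integration over boxes -/

section Boxes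

variable {n d : ℕ}

/-- The closed box of side length `h` in one block `ℝᵈ`, with lower corner `c`. -/
def blockBox (c : Fin d → ℝ) (h : ℝ) : Set (EuclideanSpace ℝ (Fin d)) :=
  {x | ∀ k, x k ∈ Set.Icc (c k) (c k + h)}

/-- The closed box of side length `h` in `ℝᵈ × ⋯ × ℝᵈ`, with lower corner `c`. -/
def box (c : Fin n × Fin d → ℝ) (h : ℝ) : Set (Pt n d) :=
  {x | ∀ i k, x i k ∈ Set.Icc (c (i, k)) (c (i, k) + h)}

theorem blockBox_eq_preimage (c : Fin d → ℝ) (h : ℝ) :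
    blockBox c h = WithLp.ofLp ⁻¹' Set.univ.pi fun k => Set.Icc (c k) (c k + h) := by
  ext x; simp only [blockBox, Set.mem_preimage, Set.mem_univ_pi, Set.mem_ofPred_eq]

theorem box_eq_pi (c : Fin n × Fin d → ℝ) (h : ℝ) :
    box c h = Set.univ.pi fun i => blockBox (fun k => c (i, k)) h := by
  ext x; simp only [box, blockBox, Set.mem_univ_pi, Set.mem_ofPred_eq]

theorem cube_eq_box : cube n d = box (fun _ => -(1 / 2)) 1 := by
  ext x; simp only [cube, box]; norm_num

theorem isCompact_blockBox (c : Fin d → ℝ) (h : ℝ) : IsCompact (blockBox c h) := by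
  rw [blockBox_eq_preimage]
  exact (EuclideanSpace.equiv (Fin d) ℝ).toHomeomorph.isCompact_preimage.2
    (isCompact_univ_pi fun k => isCompact_Icc)

theorem isCompact_box (c : Fin n × Fin d → ℝ) (h : ℝ) : IsCompact (box c h) := by
  rw [box_eq_pi]
  exact isCompact_univ_pi fun i => isCompact_blockBox _ _

theorem isCompact_cube : IsCompact (cube n d) := by
  rw [cube_eq_box]; exact isCompact_box _ _

theorem convex_box (c : Fin n × Fin d → ℝ) (h : ℝ) : Convex ℝ (box c h) := by
  intro x hx y hy a b ha hb hab i k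
  have h1 := hx i k
  have h2 := hy i k
  exact (convex_Icc (c (i, k)) (c (i, k) + h)) h1 h2 ha hb hab

theorem setIntegral_blockBox_prod (c : Fin d → ℝ) (h : ℝ) (φ : Fin d → ℝ → ℝ) :
    ∫ x in blockBox c h, ∏ k, φ k (x k) = ∏ k, ∫ t in Set.Icc (c k) (c k + h), φ k t := by
  rw [blockBox_eq_preimage, (PiLp.volume_preserving_ofLp (Fin d)).setIntegral_preimage_emb
    (MeasurableEquiv.toLp 2 (Fin d → ℝ)).symm.measurableEmbedding
    (fun y => ∏ k, φ k (y k)) (Set.univ.pi fun k => Set.Icc (c k) (c k + h)),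
    volume_pi, Measure.restrict_pi_pi]
  exact integral_fintype_prod_eq_prod _

theorem setIntegral_box_prod (c : Fin n × Fin d → ℝ) (h : ℝ)
    (w : Fin n → EuclideanSpace ℝ (Fin d) → ℝ) :
    ∫ x in box c h, ∏ i, w i (x i) = ∏ i, ∫ y in blockBox (fun k => c (i, k)) h, w i y := by
  rw [box_eq_pi, volume_pi, Measure.restrict_pi_pi]
  exact integral_fintype_prod_eq_prod _

theorem integrableOn_box_prod (c : Fin n × Fin d → ℝ) (h : ℝ)
    (w : Fin n → EuclideanSpace ℝ (Fin d) → ℝ)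
    (hw : ∀ i, IntegrableOn (w i) (blockBox (fun k => c (i, k)) h)) :
    IntegrableOn (fun x : Pt n d => ∏ i, w i (x i)) (box c h) := by
  rw [IntegrableOn, box_eq_pi, volume_pi, Measure.restrict_pi_pi]
  exact Integrable.fintype_prod hw

theorem setIntegral_box_prod_coord (c : Fin n × Fin d → ℝ) (h : ℝ)
    (φ : Fin n × Fin d → ℝ → ℝ) :
    ∫ x in box c h, ∏ l, φ l (x l.1 l.2) = ∏ l, ∫ t in Set.Icc (c l) (c l + h), φ l t := by
  simp only [Fintype.prod_prod_type]
  rw [setIntegral_box_prod c h fun i y => ∏ k, φ (i, k) (y k)]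
  exact Finset.prod_congr rfl fun i _ => setIntegral_blockBox_prod _ h fun k => φ (i, k)

end Boxes

/-! ### Bernoulli weights -/

section Bernoulli

variable {n d : ℕ}

/-- The weight `∏ B_{β_l}(t_l) / β_l!`, so that `emCoeff β = -bernWeight β`. -/
noncomputable def bernWeight (β : MultiIndex n d) (t : Fin n × Fin d → ℝ) : ℝ :=
  ∏ l, bernoulliFun (β l) (t l) / ((β l).factorial : ℝ)

/-- The position of `x` relative to the box with lower corner `c` and side length `h`. -/
noncomputable def relCoord (c : Fin n × Fin d → ℝ) (h : ℝ) (x : Pt n d) : Fin n × Fin d → ℝ :=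
  fun l => (x l.1 l.2 - c l) / h

theorem bernWeight_zero (t : Fin n × Fin d → ℝ) : bernWeight 0 t = 1 := by
  simp [bernWeight]

theorem emCoeff_eq_neg_bernWeight (β : MultiIndex n d) (t : Fin n × Fin d → ℝ) :
    emCoeff β t = -bernWeight β t := rfl

theorem integral_bernoulliFun_scaled (k : ℕ) (c : ℝ) {h : ℝ} (hh : 0 < h) :
    ∫ t in Set.Icc c (c + h), bernoulliFun k ((t - c) / h) / (k.factorial : ℝ)
      = if k = 0 then h else 0 := by
  rw [integral_Icc_eq_integral_Ioc, ← intervalIntegral.integral_of_le (by linarith)]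
  simp only [sub_div, intervalIntegral.integral_div]
  rw [intervalIntegral.integral_comp_div_sub (bernoulliFun k) hh.ne' (c / h)]
  have h1 : c / h - c / h = 0 := sub_self _
  have h2 : (c + h) / h - c / h = 1 := by field_simp; ring
  rw [h1, h2, integral_bernoulliFun]
  by_cases hk : k = 0 <;> simp [hk]

theorem setIntegral_bernWeight (β : MultiIndex n d) (c : Fin n × Fin d → ℝ) {h : ℝ}
    (hh : 0 < h) :
    ∫ x in box c h, bernWeight β (relCoord c h x) = if β = 0 then h ^ (n * d) else 0 := by
  have := setIntegral_box_prod_coord c h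
    fun l t => bernoulliFun (β l) ((t - c l) / h) / ((β l).factorial : ℝ)
  simp only [bernWeight, relCoord]
  rw [this]
  simp only [integral_bernoulliFun_scaled _ _ hh]
  split_ifs with h0
  · simp [h0, Fintype.card_prod]
  · obtain ⟨l, hl⟩ := Function.ne_iff.1 h0
    exact Finset.prod_eq_zero (Finset.mem_univ l) (if_neg hl)

theorem hasDerivAt_bernoulliFun_div (k : ℕ) (x : ℝ) :
    HasDerivAt (fun x => bernoulliFun k x / (k.factorial : ℝ))
      (if k = 0 then 0 else bernoulliFun (k - 1) x / ((k - 1).factorial : ℝ)) x := by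
  have h := (hasDerivAt_bernoulliFun k x).div_const (k.factorial : ℝ)
  refine h.congr_deriv ?_
  split_ifs with hk
  · simp [hk]
  · obtain ⟨j, rfl⟩ := Nat.exists_eq_succ_of_ne_zero hk
    simp only [Nat.succ_eq_add_one, Nat.add_sub_cancel, Nat.factorial_succ]
    push_cast
    field_simp

/-- The coordinate functions as continuous linear maps. -/
noncomputable def coordL (l : Fin n × Fin d) : Pt n d →L[ℝ] ℝ :=
  (EuclideanSpace.proj l.2).comp (ContinuousLinearMap.proj l.1)

theorem coordL_apply (l : Fin n × Fin d) (x : Pt n d) : coordL l x = x l.1 l.2 := rfl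

theorem coordL_unitVec (l k : Fin n × Fin d) :
    coordL l (unitVec k : Pt n d) = if l = k then 1 else 0 := by
  obtain ⟨i, a⟩ := l
  obtain ⟨j, b⟩ := k
  simp only [coordL_apply, unitVec, Prod.mk.injEq]
  by_cases h : i = j
  · subst h; simp
  · simp [h]

theorem eq_sum_smul_unitVec (x : Pt n d) : x = ∑ l, (x l.1 l.2) • unitVec l := by
  have : ∀ k : Fin n × Fin d, coordL k x = coordL k (∑ l, (x l.1 l.2) • unitVec l) := by
    intro k
    rw [map_sum]
    simp [coordL_unitVec, ← coordL_apply]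
  funext i
  ext k
  exact this (i, k)

theorem hasFDerivAt_bernWeight (β : MultiIndex n d) (c : Fin n × Fin d → ℝ) (h : ℝ)
    (x : Pt n d) :
    ∃ L : Pt n d →L[ℝ] ℝ, HasFDerivAt (fun x => bernWeight β (relCoord c h x)) L x ∧
      ∀ l, L (unitVec l) =
        h⁻¹ * if β l = 0 then 0 else bernWeight (β - Pi.single l 1) (relCoord c h x) := by
  have h1 : ∀ l : Fin n × Fin d, HasFDerivAt
      (fun x : Pt n d => bernoulliFun (β l) (relCoord c h x l) / ((β l).factorial : ℝ))
      ((if β l = 0 then 0 else bernoulliFun (β l - 1) (relCoord c h x l)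
        / ((β l - 1).factorial : ℝ)) • (h⁻¹ • coordL l)) x := by
    intro l
    have h2 : HasFDerivAt (fun x : Pt n d => relCoord c h x l) (h⁻¹ • coordL l) x := by
      have h3 := (((coordL l).hasFDerivAt (x := x)).sub_const (c l)).const_smul h⁻¹
      refine h3.congr_of_eventuallyEq (Eventually.of_forall fun y => ?_)
      simp [relCoord, coordL_apply, div_eq_inv_mul]
    exact (hasDerivAt_bernoulliFun_div (β l) (relCoord c h x l)).comp_hasFDerivAt x h2
  refine ⟨_, HasFDerivAt.finsetProd fun l _ => h1 l, fun l => ?_⟩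
  simp only [sum_apply, smul_apply, smul_eq_mul,
    coordL_unitVec]
  rw [Finset.sum_eq_single l]
  · simp only [if_true, mul_one]
    split_ifs with h0
    · simp
    · have h4 : bernWeight (β - Pi.single l 1) (relCoord c h x)
          = (∏ j ∈ Finset.univ.erase l,
              bernoulliFun (β j) (relCoord c h x j) / ((β j).factorial : ℝ)) *
            (bernoulliFun (β l - 1) (relCoord c h x l) / ((β l - 1).factorial : ℝ)) := by
        rw [bernWeight, ← Finset.prod_erase_mul _ _ (Finset.mem_univ l)]
        congr 1
        · refine Finset.prod_congr rfl fun j hj => ?_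
          simp [Finset.ne_of_mem_erase hj]
        · simp
      rw [h4]; ring
  · intro j _ hj
    simp [hj]
  · simp

end Bernoulli

/-! ### The Euler-Maclaurin formula for a single node in a box -/

section CellRemainder

variable {𝕜 : Type*} [RCLike 𝕜] {n d : ℕ} {U : Set (Pt n d)} {u : Pt n d → 𝕜}

/-- The Euler-Maclaurin remainder of order `R` on the box with lower corner `c` and side length
`h`, as a function of the position `x` of the single node. -/
noncomputable def cellRemainder (R : ℕ) (c : Fin n × Fin d → ℝ) (h : ℝ) (u : Pt n d → 𝕜)
    (x : Pt n d) : 𝕜 :=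
  u x - ∑ s ∈ Finset.range R, ∑ β ∈ Finset.piAntidiag (Finset.univ : Finset (Fin n × Fin d)) s,
    bernWeight β (relCoord c h x) •
      ((h ^ s * (h ^ (n * d))⁻¹) • ∫ y in box c h, multiDeriv β u y)

theorem mem_piAntidiag_univ {β : MultiIndex n d} {s : ℕ} :
    β ∈ Finset.piAntidiag (Finset.univ : Finset (Fin n × Fin d)) s ↔ order β = s := by
  simp [Finset.mem_piAntidiag, order]

theorem integrableOn_multiDeriv_box (hU : IsOpen U) (hu : ContDiffOn ℝ ∞ u U)
    {c : Fin n × Fin d → ℝ} {h : ℝ} (hQ : box c h ⊆ U) (β : MultiIndex n d) :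
    IntegrableOn (multiDeriv β u) (box c h) :=
  ((contDiffOn_multiDeriv hU hu β).continuousOn.mono hQ).integrableOn_compact (isCompact_box c h)

theorem continuous_bernWeight (β : MultiIndex n d) (c : Fin n × Fin d → ℝ) (h : ℝ) :
    Continuous fun x : Pt n d => bernWeight β (relCoord c h x) :=
  continuous_iff_continuousAt.2 fun x =>
    let ⟨_, hL, _⟩ := hasFDerivAt_bernWeight β c h x
    hL.continuousAt

theorem differentiableAt_cellRemainder (hU : IsOpen U) (hu : ContDiffOn ℝ ∞ u U) (R : ℕ)
    (c : Fin n × Fin d → ℝ) (h : ℝ) {x : Pt n d} (hx : x ∈ U) :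
    DifferentiableAt ℝ (cellRemainder R c h u) x := by
  have h1 : DifferentiableAt ℝ u x :=
    (hu.contDiffAt (hU.mem_nhds hx)).differentiableAt (by simp)
  refine h1.sub (DifferentiableAt.fun_sum fun s _ => DifferentiableAt.fun_sum fun β _ => ?_)
  obtain ⟨L, hL, -⟩ := hasFDerivAt_bernWeight β c h x
  exact hL.differentiableAt.smul_const _

theorem integral_multiDeriv_add_single (hU : IsOpen U) (hu : ContDiffOn ℝ ∞ u U)
    {c : Fin n × Fin d → ℝ} {h : ℝ} (hQ : box c h ⊆ U) (β : MultiIndex n d)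
    (l : Fin n × Fin d) :
    ∫ y in box c h, multiDeriv (β + Pi.single l 1) u y
      = ∫ y in box c h, multiDeriv β (partialDeriv l u) y :=
  setIntegral_congr_fun (isCompact_box c h).measurableSet
    ((multiDeriv_add_single hU hu β l).mono hQ)

theorem sum_piAntidiag_succ {E : Type*} [AddCommMonoid E] (s : ℕ) (l : Fin n × Fin d)
    (G : MultiIndex n d → E) :
    (∑ β ∈ Finset.piAntidiag (Finset.univ : Finset (Fin n × Fin d)) (s + 1),
        if β l = 0 then 0 else G (β - Pi.single l 1))
      = ∑ β ∈ Finset.piAntidiag (Finset.univ : Finset (Fin n × Fin d)) s, G β := by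
  have hs : (∑ β ∈ Finset.piAntidiag (Finset.univ : Finset (Fin n × Fin d)) (s + 1),
        if β l = 0 then 0 else G (β - Pi.single l 1))
      = ∑ β ∈ (Finset.piAntidiag (Finset.univ : Finset (Fin n × Fin d)) (s + 1)).filter
          fun β => ¬ β l = 0, G (β - Pi.single l 1) := by
    rw [Finset.sum_filter]
    exact Finset.sum_congr rfl fun β _ => by split_ifs <;> rfl
  rw [hs]
  have hsub : ∀ β : MultiIndex n d, β l ≠ 0 → β - Pi.single l 1 + Pi.single l 1 = β := fun β hβ =>
    sub_single_add_single hβ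
  refine Finset.sum_nbij' (fun β => β - Pi.single l 1) (fun β => β + Pi.single l 1) ?_ ?_ ?_ ?_ ?_
  · intro β hβ
    rw [Finset.mem_filter, mem_piAntidiag_univ] at hβ
    rw [mem_piAntidiag_univ]
    have := hsub β hβ.2
    have h2 := order_add_single (β - Pi.single l 1) l
    rw [this] at h2
    omega
  · intro β hβ
    rw [mem_piAntidiag_univ] at hβ
    rw [Finset.mem_filter, mem_piAntidiag_univ, order_add_single]
    exact ⟨by omega, by simp⟩
  · intro β hβ
    rw [Finset.mem_filter] at hβ
    exact hsub β hβ.2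
  · intro β _
    simp
  · intro β _
    rfl

/-- Differentiating the remainder lowers its order by one, because the Bernoulli polynomials form
an Appell sequence. -/
theorem partialDeriv_cellRemainder (hU : IsOpen U) (hu : ContDiffOn ℝ ∞ u U) (R : ℕ)
    {c : Fin n × Fin d → ℝ} {h : ℝ} (hh : 0 < h) (hQ : box c h ⊆ U) (l : Fin n × Fin d)
    {x : Pt n d} (hx : x ∈ U) :
    partialDeriv l (cellRemainder (R + 1) c h u) x
      = cellRemainder R c h (partialDeriv l u) x := by
  have h1 : DifferentiableAt ℝ u x :=
    (hu.contDiffAt (hU.mem_nhds hx)).differentiableAt (by simp)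
  choose L hL hLe using fun β : MultiIndex n d => hasFDerivAt_bernWeight β c h x
  have h2 : HasFDerivAt (cellRemainder (R + 1) c h u)
      (fderiv ℝ u x - ∑ s ∈ Finset.range (R + 1),
        ∑ β ∈ Finset.piAntidiag (Finset.univ : Finset (Fin n × Fin d)) s,
          (L β).smulRight ((h ^ s * (h ^ (n * d))⁻¹) • ∫ y in box c h, multiDeriv β u y)) x :=
    h1.hasFDerivAt.sub (HasFDerivAt.fun_sum fun s _ => HasFDerivAt.fun_sum fun β _ =>
      (hL β).smul_const _)
  rw [partialDeriv, h2.fderiv]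
  simp only [sub_apply, sum_apply, ContinuousLinearMap.smulRight_apply, hLe]
  rw [cellRemainder, ← partialDeriv]
  congr 1
  rw [Finset.sum_range_succ']
  have h0 : (∑ β ∈ Finset.piAntidiag (Finset.univ : Finset (Fin n × Fin d)) 0,
      (h⁻¹ * if β l = 0 then 0 else bernWeight (β - Pi.single l 1) (relCoord c h x)) •
        (h ^ 0 * (h ^ (n * d))⁻¹) • ∫ y in box c h, multiDeriv β u y) = 0 := by
    refine Finset.sum_eq_zero fun β hβ => ?_
    have := eq_zero_of_order_eq_zero (mem_piAntidiag_univ.1 hβ)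
    simp [this]
  rw [h0, add_zero]
  refine Finset.sum_congr rfl fun s _ => ?_
  rw [← sum_piAntidiag_succ s l]
  refine Finset.sum_congr rfl fun β _ => ?_
  split_ifs with hβ
  · simp
  · rw [← integral_multiDeriv_add_single hU hu hQ, sub_single_add_single hβ, smul_smul, smul_smul]
    congr 1
    field_simp
    ring

theorem setIntegral_cellRemainder (hU : IsOpen U) (hu : ContDiffOn ℝ ∞ u U) (R : ℕ)
    {c : Fin n × Fin d → ℝ} {h : ℝ} (hh : 0 < h) (hQ : box c h ⊆ U) :
    ∫ x in box c h, cellRemainder (R + 1) c h u x = 0 := by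
  have hint : ∀ (β : MultiIndex n d) (v : 𝕜),
      IntegrableOn (fun x => bernWeight β (relCoord c h x) • v) (box c h) := fun β v =>
    ((continuous_bernWeight β c h).smul continuous_const).continuousOn.integrableOn_compact
      (isCompact_box c h)
  have hu0 : IntegrableOn u (box c h) := by
    simpa only [multiDeriv_zero] using integrableOn_multiDeriv_box hU hu hQ 0
  simp only [cellRemainder]
  rw [integral_sub hu0
    (integrable_finsetSum _ fun s _ => integrable_finsetSum _ fun β _ => hint β _),
    integral_finsetSum _ fun s _ => integrable_finsetSum _ fun β _ => hint β _]
  have h1 : ∀ s ∈ Finset.range (R + 1),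
      ∫ x in box c h, ∑ β ∈ Finset.piAntidiag (Finset.univ : Finset (Fin n × Fin d)) s,
        bernWeight β (relCoord c h x) •
          ((h ^ s * (h ^ (n * d))⁻¹) • ∫ y in box c h, multiDeriv β u y)
      = if s = 0 then ∫ y in box c h, u y else 0 := by
    intro s _
    rw [integral_finsetSum _ fun β _ => hint β _]
    simp only [integral_smul_const, setIntegral_bernWeight _ c hh]
    split_ifs with hs
    · subst hs
      rw [Finset.sum_eq_single 0]
      · have : h ^ (n * d) ≠ 0 := by positivity
        simp [multiDeriv_zero, smul_smul, this]
      · intro β hβ hβ0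
        simp [hβ0]
      · intro h0
        exact absurd (mem_piAntidiag_univ.2 (by simp [order])) h0
    · refine Finset.sum_eq_zero fun β hβ => ?_
      have : β ≠ 0 := by
        rintro rfl
        exact hs (by simpa [order] using (mem_piAntidiag_univ.1 hβ).symm)
      simp [this]
  rw [Finset.sum_congr rfl h1]
  simp

theorem measureReal_box (c : Fin n × Fin d → ℝ) {h : ℝ} (hh : 0 < h) :
    volume.real (box c h) = h ^ (n * d) := by
  have := setIntegral_bernWeight (0 : MultiIndex n d) c hh
  simpa [bernWeight_zero] using this

/-- A function on a box with mean zero is bounded by its oscillation. -/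
theorem norm_le_of_setIntegral_eq_zero {F : Pt n d → 𝕜} {c : Fin n × Fin d → ℝ} {h D : ℝ}
    (hh : 0 < h) (hF : ContinuousOn F (box c h)) (h0 : ∫ x in box c h, F x = 0)
    {x : Pt n d} (hD : ∀ y ∈ box c h, ‖F x - F y‖ ≤ D) : ‖F x‖ ≤ D := by
  have hpos : 0 < h ^ (n * d) := by positivity
  have hv : volume (box c h) < ⊤ := (isCompact_box c h).measure_lt_top
  have h1 : ∫ y in box c h, (F x - F y) = (h ^ (n * d)) • F x := by
    rw [integral_sub (continuousOn_const.integrableOn_compact (isCompact_box c h))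
      (hF.integrableOn_compact (isCompact_box c h)),
      h0, sub_zero, setIntegral_const, measureReal_box c hh]
  have h2 := norm_setIntegral_le_of_norm_le_const hv hD
  rw [h1, measureReal_box c hh, norm_smul, Real.norm_of_nonneg hpos.le, mul_comm] at h2
  exact le_of_mul_le_mul_right h2 hpos

theorem norm_sub_le_of_partialDeriv_le {F : Pt n d → 𝕜} {c : Fin n × Fin d → ℝ} {h B : ℝ}
    (hh : 0 < h) (hF : ∀ x ∈ box c h, DifferentiableAt ℝ F x)
    (hB : ∀ l, ∀ x ∈ box c h, ‖partialDeriv l F x‖ ≤ B) {x y : Pt n d} (hx : x ∈ box c h)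
    (hy : y ∈ box c h) : ‖F x - F y‖ ≤ (n * d : ℕ) * h * B := by
  have hseg : ∀ t ∈ Set.Icc (0 : ℝ) 1, y + t • (x - y) ∈ box c h := fun t ht =>
    (convex_box c h).add_smul_sub_mem hy hx ht
  have hder : ∀ t ∈ Set.Icc (0 : ℝ) 1, HasDerivWithinAt (fun t : ℝ => F (y + t • (x - y)))
      (fderiv ℝ F (y + t • (x - y)) (x - y)) (Set.Icc 0 1) t := by
    intro t ht
    have h1 : HasDerivAt (fun t : ℝ => y + t • (x - y)) (x - y) t := by
      simpa using ((hasDerivAt_id t).smul_const (x - y)).const_add y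
    exact ((hF _ (hseg t ht)).hasFDerivAt.comp_hasDerivAt t h1).hasDerivWithinAt
  have hbd : ∀ t ∈ Set.Ico (0 : ℝ) 1,
      ‖fderiv ℝ F (y + t • (x - y)) (x - y)‖ ≤ (n * d : ℕ) * h * B := by
    intro t ht
    have hz := hseg t (Set.Ico_subset_Icc_self ht)
    rw [eq_sum_smul_unitVec (x - y), map_sum, ← eq_sum_smul_unitVec]
    refine (norm_sum_le _ _).trans ?_
    have h3 : ∀ l ∈ (Finset.univ : Finset (Fin n × Fin d)),
        ‖fderiv ℝ F (y + t • (x - y)) (((x - y) l.1 l.2) • unitVec l)‖ ≤ h * B := by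
      intro l _
      rw [map_smul, norm_smul]
      refine mul_le_mul ?_ (hB l _ hz) (norm_nonneg _) hh.le
      have hx' := hx l.1 l.2
      have hy' := hy l.1 l.2
      simp only [Set.mem_Icc] at hx' hy'
      rw [Real.norm_eq_abs, abs_le]
      simp only [Pi.sub_apply, PiLp.sub_apply]
      constructor <;> linarith [hx'.1, hx'.2, hy'.1, hy'.2]
    refine (Finset.sum_le_sum h3).trans (le_of_eq ?_)
    simp [Fintype.card_prod]; ring
  have := norm_image_sub_le_of_norm_deriv_le_segment_01' hder hbd
  simpa using this

/-- The Euler-Maclaurin formula for a single node in a box on which `u` is smooth. -/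
theorem norm_cellRemainder_le (hU : IsOpen U) (R : ℕ) {c : Fin n × Fin d → ℝ} {h : ℝ}
    (hh : 0 < h) (hQ : box c h ⊆ U) {A : ℝ} (u : Pt n d → 𝕜) (hu : ContDiffOn ℝ ∞ u U)
    (hA : ∀ β : MultiIndex n d, order β = R → ∀ x ∈ box c h, ‖multiDeriv β u x‖ ≤ A) :
    ∀ x ∈ box c h, ‖cellRemainder R c h u x‖ ≤ ((n * d : ℕ) * h) ^ R * A := by
  induction R generalizing u with
  | zero =>
    intro x hx
    have := hA 0 (by simp [order]) x hx
    simpa [cellRemainder, multiDeriv_zero] using this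
  | succ R ih =>
    intro x hx
    have hdiff : ∀ x ∈ box c h, DifferentiableAt ℝ (cellRemainder (R + 1) c h u) x :=
      fun x hx => differentiableAt_cellRemainder hU hu _ c h (hQ hx)
    refine norm_le_of_setIntegral_eq_zero hh
      (fun x hx => (hdiff x hx).continuousAt.continuousWithinAt)
      (setIntegral_cellRemainder hU hu R hh hQ) fun y hy => ?_
    have hB : ∀ l, ∀ x ∈ box c h,
        ‖partialDeriv l (cellRemainder (R + 1) c h u) x‖ ≤ ((n * d : ℕ) * h) ^ R * A := by
      intro l x hx
      rw [partialDeriv_cellRemainder hU hu R hh hQ l (hQ hx)]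
      refine ih (partialDeriv l u) (contDiffOn_partialDeriv hU hu l) (fun β hβ x hx => ?_) x hx
      rw [← multiDeriv_add_single hU hu β l (hQ hx)]
      exact hA _ (by rw [order_add_single, hβ]) x hx
    refine (norm_sub_le_of_partialDeriv_le hh hdiff hB hx hy).trans (le_of_eq ?_)
    rw [pow_succ]; ring

end CellRemainder

/-! ### Symbol bounds -/

section SymbolBounds

variable {𝕜 : Type*} [RCLike 𝕜] {n d : ℕ} {u v : Pt n d → 𝕜} {w w' : Pt n d → ℝ}
  {C C' : ℝ} {R : ℕ}

/-- The set where all blocks `xᵢ` are nonzero. -/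
def regularSet (n d : ℕ) : Set (Pt n d) := {x | ∀ i, x i ≠ 0}

theorem isOpen_regularSet : IsOpen (regularSet n d) := by
  have : regularSet n d = ⋂ i, (fun x : Pt n d => x i) ⁻¹' {0}ᶜ := by
    ext x; simp [regularSet]
  rw [this]
  exact isOpen_iInter_of_finite fun i => isOpen_compl_singleton.preimage (continuous_apply i)

/-- The sum `∑ᵢ |xᵢ|⁻¹`, comparable with the inverse distance to the singular set. -/
noncomputable def invSum (x : Pt n d) : ℝ := ∑ i, ‖x i‖⁻¹

theorem invSum_nonneg (x : Pt n d) : 0 ≤ invSum x :=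
  Finset.sum_nonneg fun _ _ => inv_nonneg.2 (norm_nonneg _)

theorem inv_norm_le_invSum (x : Pt n d) (i : Fin n) : ‖x i‖⁻¹ ≤ invSum x :=
  Finset.single_le_sum (f := fun i => ‖x i‖⁻¹) (fun _ _ => inv_nonneg.2 (norm_nonneg _))
    (Finset.mem_univ i)

/-- `u` and its derivatives up to order `R` satisfy `|∂^β u| ≤ C w (∑ᵢ |xᵢ|⁻¹)^|β|` on the regular
part of the cube: each derivative costs at most one factor `∑ᵢ |xᵢ|⁻¹`. -/
def SymbolBound (C : ℝ) : ℕ → (Pt n d → ℝ) → (Pt n d → 𝕜) → Prop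
  | 0, w, u => ∀ x ∈ cube n d ∩ regularSet n d, ‖u x‖ ≤ C * w x
  | R + 1, w, u => (∀ x ∈ cube n d ∩ regularSet n d, ‖u x‖ ≤ C * w x) ∧
      ∀ l, SymbolBound C R (fun x => w x * invSum x) (partialDeriv l u)

namespace SymbolBound

theorem congr (h : SymbolBound C R w u) (huv : Set.EqOn u v (regularSet n d)) :
    SymbolBound C R w v := by
  induction R generalizing u v w with
  | zero => intro x hx; rw [← huv hx.2]; exact h x hx
  | succ R ih =>
    refine ⟨fun x hx => ?_, fun l => ih (h.2 l) (partialDeriv_congr isOpen_regularSet huv l)⟩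
    rw [← huv hx.2]; exact h.1 x hx

theorem of_succ (h : SymbolBound C (R + 1) w u) : SymbolBound C R w u := by
  induction R generalizing u w with
  | zero => exact h.1
  | succ R ih => exact ⟨h.1, fun l => ih (h.2 l)⟩

theorem mono (h : SymbolBound C R w u)
    (hw : ∀ x ∈ cube n d ∩ regularSet n d, C * w x ≤ C' * w' x) : SymbolBound C' R w' u := by
  induction R generalizing u w w' with
  | zero => exact fun x hx => (h x hx).trans (hw x hx)
  | succ R ih =>
    refine ⟨fun x hx => (h.1 x hx).trans (hw x hx), fun l => ih (h.2 l) fun x hx => ?_⟩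
    have := mul_le_mul_of_nonneg_right (hw x hx) (invSum_nonneg x)
    linarith

theorem const {a : 𝕜} (h : ∀ x ∈ cube n d ∩ regularSet n d, ‖a‖ ≤ C * w x) :
    SymbolBound C R w (fun _ => a) := by
  induction R generalizing a w with
  | zero => exact h
  | succ R ih =>
    refine ⟨h, fun l => ?_⟩
    have h0 : partialDeriv l (fun _ : Pt n d => a) = fun _ => 0 := by
      funext x; simp [partialDeriv]
    rw [h0]
    refine ih fun x hx => ?_
    rw [norm_zero, ← mul_assoc]
    exact mul_nonneg ((norm_nonneg a).trans (h x hx)) (invSum_nonneg x)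

theorem add (hu : ContDiffOn ℝ ∞ u (regularSet n d)) (hv : ContDiffOn ℝ ∞ v (regularSet n d))
    (h : SymbolBound C R w u) (h' : SymbolBound C' R w v) :
    SymbolBound (C + C') R w (fun x => u x + v x) := by
  induction R generalizing u v w with
  | zero =>
    intro x hx
    rw [add_mul]
    exact (norm_add_le _ _).trans (add_le_add (h x hx) (h' x hx))
  | succ R ih =>
    refine ⟨fun x hx => ?_, fun l => ?_⟩
    · rw [add_mul]
      exact (norm_add_le _ _).trans (add_le_add (h.1 x hx) (h'.1 x hx))
    · refine (ih (contDiffOn_partialDeriv isOpen_regularSet hu l)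
        (contDiffOn_partialDeriv isOpen_regularSet hv l) (h.2 l) (h'.2 l)).congr fun x hx => ?_
      have h1 := (hu.contDiffAt (isOpen_regularSet.mem_nhds hx)).differentiableAt (by simp)
      have h2 := (hv.contDiffAt (isOpen_regularSet.mem_nhds hx)).differentiableAt (by simp)
      simp only [partialDeriv]
      rw [fderiv_fun_add h1 h2, add_apply]

/-- The product rule for symbol bounds. -/
theorem mul (hu : ContDiffOn ℝ ∞ u (regularSet n d)) (hv : ContDiffOn ℝ ∞ v (regularSet n d))
    (h : SymbolBound C R w u) (h' : SymbolBound C' R w' v) :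
    SymbolBound (2 ^ R * (C * C')) R (fun x => w x * w' x) (fun x => u x * v x) := by
  have base : ∀ {u v : Pt n d → 𝕜} {w w' : Pt n d → ℝ} {x : Pt n d},
      ‖u x‖ ≤ C * w x → ‖v x‖ ≤ C' * w' x → ‖u x * v x‖ ≤ C * C' * (w x * w' x) := by
    intro u v w w' x h1 h2
    rw [norm_mul]
    refine (mul_le_mul h1 h2 (norm_nonneg _) ((norm_nonneg _).trans h1)).trans (le_of_eq ?_)
    ring
  induction R generalizing u v w w' with
  | zero =>
    intro x hx
    rw [pow_zero, one_mul]
    exact base (h x hx) (h' x hx)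
  | succ R ih =>
    refine ⟨fun x hx => ?_, fun l => ?_⟩
    · have h1 := base (h.1 x hx) (h'.1 x hx)
      have h2 : (1 : ℝ) ≤ 2 ^ (R + 1) := one_le_pow₀ (by norm_num)
      have h3 := (norm_nonneg _).trans h1
      calc ‖u x * v x‖ ≤ 1 * (C * C' * (w x * w' x)) := by rw [one_mul]; exact h1
        _ ≤ 2 ^ (R + 1) * (C * C' * (w x * w' x)) := mul_le_mul_of_nonneg_right h2 h3
        _ = _ := by ring
    · have hu' := contDiffOn_partialDeriv isOpen_regularSet hu l
      have hv' := contDiffOn_partialDeriv isOpen_regularSet hv l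
      have h1 := ih hu' hv (h.2 l) h'.of_succ
      have h2 := ih hu hv' h.of_succ (h'.2 l)
      have h1' : SymbolBound (2 ^ R * (C * C')) R (fun x => w x * w' x * invSum x)
          (fun x => partialDeriv l u x * v x) := h1.mono fun x _ => le_of_eq (by ring)
      have h2' : SymbolBound (2 ^ R * (C * C')) R (fun x => w x * w' x * invSum x)
          (fun x => u x * partialDeriv l v x) := h2.mono fun x _ => le_of_eq (by ring)
      refine ((add (hu'.mul hv) (hu.mul hv') h1' h2').congr fun x hx => ?_).mono
        fun x _ => le_of_eq (by ring)
      have h3 := (hu.contDiffAt (isOpen_regularSet.mem_nhds hx)).differentiableAt (by simp)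
      have h4 := (hv.contDiffAt (isOpen_regularSet.mem_nhds hx)).differentiableAt (by simp)
      simp only [partialDeriv]
      rw [fderiv_fun_mul h3 h4]
      simp only [add_apply, smul_apply, smul_eq_mul]
      ring

theorem prod {ι : Type*} (s : Finset ι) {u : ι → Pt n d → 𝕜} {w : ι → Pt n d → ℝ} {C : ι → ℝ}
    (hu : ∀ i ∈ s, ContDiffOn ℝ ∞ (u i) (regularSet n d))
    (h : ∀ i ∈ s, SymbolBound (C i) R (w i) (u i)) :
    SymbolBound ((2 ^ R) ^ s.card * ∏ i ∈ s, C i) R (fun x => ∏ i ∈ s, w i x)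
      (fun x => ∏ i ∈ s, u i x) := by
  classical
  induction s using Finset.induction_on with
  | empty => simpa using const (a := (1 : 𝕜)) (w := fun _ => 1) (C := 1) (by simp)
  | insert i s hi ih =>
    have h1 := ih (fun j hj => hu j (Finset.mem_insert_of_mem hj))
      fun j hj => h j (Finset.mem_insert_of_mem hj)
    have h2 := mul (hu i (Finset.mem_insert_self i s))
      (contDiffOn_prod fun j hj => hu j (Finset.mem_insert_of_mem hj))
      (h i (Finset.mem_insert_self i s)) h1
    simp only [Finset.prod_insert hi, Finset.card_insert_of_notMem hi]
    refine h2.mono fun x _ => le_of_eq ?_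
    rw [pow_succ]; ring

theorem exists_sum {ι : Type*} (s : Finset ι) {u : ι → Pt n d → 𝕜}
    (hu : ∀ i ∈ s, ContDiffOn ℝ ∞ (u i) (regularSet n d))
    (h : ∀ i ∈ s, ∃ C, SymbolBound C R w (u i)) :
    ∃ C, SymbolBound C R w (fun x => ∑ i ∈ s, u i x) := by
  classical
  induction s using Finset.induction_on with
  | empty => exact ⟨0, by simpa using const (a := (0 : 𝕜)) (by simp)⟩
  | insert i s hi ih =>
    obtain ⟨C₁, h1⟩ := ih (fun j hj => hu j (Finset.mem_insert_of_mem hj))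
      fun j hj => h j (Finset.mem_insert_of_mem hj)
    obtain ⟨C₂, h2⟩ := h i (Finset.mem_insert_self i s)
    refine ⟨C₂ + C₁, ?_⟩
    simp only [Finset.sum_insert hi]
    exact add (hu i (Finset.mem_insert_self i s))
      (ContDiffOn.sum fun j hj => hu j (Finset.mem_insert_of_mem hj)) h2 h1

theorem ofReal {φ : Pt n d → ℝ} (hφ : ContDiffOn ℝ ∞ φ (regularSet n d))
    (h : SymbolBound C R w φ) : SymbolBound C R w (fun x => (φ x : 𝕜)) := by
  induction R generalizing φ w with
  | zero => intro x hx; simpa using h x hx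
  | succ R ih =>
    refine ⟨fun x hx => by simpa using h.1 x hx, fun l => ?_⟩
    refine (ih (contDiffOn_partialDeriv isOpen_regularSet hφ l) (h.2 l)).congr fun x hx => ?_
    have h3 := (hφ.contDiffAt (isOpen_regularSet.mem_nhds hx)).differentiableAt (by simp)
    have h4 : HasFDerivAt (fun x => (φ x : 𝕜)) ((RCLike.ofRealCLM (K := 𝕜)).comp (fderiv ℝ φ x))
        x := (RCLike.ofRealCLM (K := 𝕜)).hasFDerivAt.comp x h3.hasFDerivAt
    simp only [partialDeriv]
    rw [h4.fderiv]
    rfl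

theorem multiDeriv_le (hu : ContDiffOn ℝ ∞ u (regularSet n d)) (h : SymbolBound C R w u)
    (β : MultiIndex n d) (hβ : order β ≤ R) :
    ∀ x ∈ cube n d ∩ regularSet n d, ‖multiDeriv β u x‖ ≤ C * (w x * invSum x ^ order β) := by
  induction R generalizing u w β with
  | zero =>
    intro x hx
    have h0 := Nat.le_zero.1 hβ
    rw [h0, eq_zero_of_order_eq_zero h0, multiDeriv_zero, pow_zero, mul_one]
    exact h x hx
  | succ R ih =>
    intro x hx
    cases hs : order β with
    | zero =>
      rw [eq_zero_of_order_eq_zero hs, multiDeriv_zero, pow_zero, mul_one]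
      exact h.1 x hx
    | succ s =>
      obtain ⟨β', l, h1, rfl⟩ := exists_eq_add_single hs
      rw [multiDeriv_add_single isOpen_regularSet hu β' l hx.2]
      have h2 := ih (contDiffOn_partialDeriv isOpen_regularSet hu l) (h.2 l) β' (by omega) x hx
      rw [h1] at h2
      rw [pow_succ']
      simpa only [mul_assoc] using h2

theorem of_multiDeriv_le (hu : ContDiffOn ℝ ∞ u (regularSet n d))
    (h : ∀ β : MultiIndex n d, order β ≤ R → ∀ x ∈ cube n d ∩ regularSet n d,
      ‖multiDeriv β u x‖ ≤ C * (w x * invSum x ^ order β)) : SymbolBound C R w u := by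
  induction R generalizing u w with
  | zero =>
    intro x hx
    simpa [multiDeriv_zero, order] using h 0 (by simp [order]) x hx
  | succ R ih =>
    refine ⟨fun x hx => by simpa [multiDeriv_zero, order] using h 0 (by simp [order]) x hx,
      fun l => ih (contDiffOn_partialDeriv isOpen_regularSet hu l) fun β hβ x hx => ?_⟩
    rw [← multiDeriv_add_single isOpen_regularSet hu β l hx.2]
    have := h (β + Pi.single l 1) (by rw [order_add_single]; omega) x hx
    rw [order_add_single, pow_succ'] at this
    simpa only [mul_assoc] using this

end SymbolBound

end SymbolBounds

/-! ### Derivatives of the fractional form -/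

section FractionalForm

variable {𝕜 : Type*} [RCLike 𝕜] {n d : ℕ}

theorem norm_le_of_abs_coord_le {y : EuclideanSpace ℝ (Fin d)} {t : ℝ} (h : ∀ k, |y k| ≤ t) :
    ‖y‖ ≤ d * t := by
  rcases Nat.eq_zero_or_pos d with rfl | hd
  · simp [Subsingleton.elim y 0]
  have ht : 0 ≤ t := (abs_nonneg _).trans (h ⟨0, hd⟩)
  rw [EuclideanSpace.norm_eq]
  refine Real.sqrt_le_left (by positivity) |>.2 ?_
  calc ∑ i, ‖y i‖ ^ 2 ≤ ∑ _i : Fin d, t ^ 2 :=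
        Finset.sum_le_sum fun i _ => pow_le_pow_left₀ (norm_nonneg _) (h i) 2
    _ = d * t ^ 2 := by simp
    _ ≤ (d * t) ^ 2 := by
      have h1 : (1 : ℝ) ≤ d := by exact_mod_cast hd
      rw [mul_pow]
      exact mul_le_mul_of_nonneg_right (by nlinarith) (sq_nonneg t)

theorem abs_coord_le_norm (y : EuclideanSpace ℝ (Fin d)) (k : Fin d) : |y k| ≤ ‖y‖ :=
  PiLp.norm_apply_le y k

theorem norm_le_of_mem_cube {x : Pt n d} (hx : x ∈ cube n d) (i : Fin n) : ‖x i‖ ≤ d := by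
  have h : ∀ k, |x i k| ≤ 1 / 2 := fun k => abs_le.2 ⟨(hx i k).1, (hx i k).2⟩
  have := norm_le_of_abs_coord_le h
  have h0 : (0 : ℝ) ≤ d := Nat.cast_nonneg d
  linarith

/-- The quadratic form `xᵢᵀ M xᵢ` of the `i`-th block. -/
noncomputable def quadForm (M : Matrix (Fin d) (Fin d) ℝ) (i : Fin n) (x : Pt n d) : ℝ :=
  (x i).ofLp ⬝ᵥ (M *ᵥ (x i).ofLp)

theorem quadForm_eq_sum (M : Matrix (Fin d) (Fin d) ℝ) (i : Fin n) (x : Pt n d) :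
    quadForm M i x = ∑ k, ∑ l, x i k * (M k l * x i l) := by
  simp [quadForm, dotProduct, Matrix.mulVec, Finset.mul_sum]

theorem contDiff_coord (l : Fin n × Fin d) : ContDiff ℝ ∞ fun x : Pt n d => x l.1 l.2 :=
  (coordL l).contDiff

theorem contDiff_quadForm (M : Matrix (Fin d) (Fin d) ℝ) (i : Fin n) :
    ContDiff ℝ ∞ (quadForm M i : Pt n d → ℝ) := by
  have : (quadForm M i : Pt n d → ℝ) = fun x => ∑ k, ∑ l, x i k * (M k l * x i l) :=
    funext (quadForm_eq_sum M i)
  rw [this]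
  exact ContDiff.sum fun k _ => ContDiff.sum fun l _ =>
    (contDiff_coord (i, k)).mul (contDiff_const.mul (contDiff_coord (i, l)))

/-- A positive definite form is comparable with the square of the norm. -/
theorem exists_quadForm_bounds (M : Matrix (Fin d) (Fin d) ℝ) (hM : M.PosDef) :
    ∃ lo hi : ℝ, 0 < lo ∧ 0 < hi ∧ ∀ y : EuclideanSpace ℝ (Fin d),
      lo * ‖y‖ ^ 2 ≤ y.ofLp ⬝ᵥ (M *ᵥ y.ofLp) ∧ y.ofLp ⬝ᵥ (M *ᵥ y.ofLp) ≤ hi * ‖y‖ ^ 2 := by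
  set Q : EuclideanSpace ℝ (Fin d) → ℝ := fun y => y.ofLp ⬝ᵥ (M *ᵥ y.ofLp) with hQ
  have hcont : Continuous Q := by
    have : Q = fun y => ∑ k, ∑ l, y k * (M k l * y l) := by
      funext y; simp [hQ, dotProduct, Matrix.mulVec, Finset.mul_sum]
    rw [this]; fun_prop
  have hpos : ∀ y, y ≠ 0 → 0 < Q y := fun y hy => by
    have h0 : y.ofLp ≠ 0 := fun h => hy (by ext k; simp [h])
    have := hM.dotProduct_mulVec_pos h0
    simpa using this
  have hhom : ∀ (t : ℝ) y, Q (t • y) = t ^ 2 * Q y := fun t y => by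
    simp only [hQ, WithLp.ofLp_smul, Matrix.mulVec_smul, dotProduct_smul, smul_dotProduct,
      smul_eq_mul]
    ring
  rcases subsingleton_or_nontrivial (EuclideanSpace ℝ (Fin d)) with hs | hs
  · refine ⟨1, 1, one_pos, one_pos, fun y => ?_⟩
    rw [Subsingleton.elim y 0]
    simp
  have hne : (Metric.sphere (0 : EuclideanSpace ℝ (Fin d)) 1).Nonempty :=
    NormedSpace.sphere_nonempty.2 zero_le_one
  obtain ⟨y₁, hy₁, h1⟩ := (isCompact_sphere _ _).exists_isMinOn hne hcont.continuousOn
  obtain ⟨y₂, hy₂, h2⟩ := (isCompact_sphere _ _).exists_isMaxOn hne hcont.continuousOn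
  have hne0 : ∀ y ∈ Metric.sphere (0 : EuclideanSpace ℝ (Fin d)) 1, y ≠ 0 := by
    rintro y hy rfl
    simp at hy
  refine ⟨Q y₁, Q y₂, hpos _ (hne0 _ hy₁), hpos _ (hne0 _ hy₂), fun y => ?_⟩
  by_cases hy : y = 0
  · subst hy; simp
  have hn : ‖y‖ ≠ 0 := norm_ne_zero_iff.2 hy
  have hmem : ‖y‖⁻¹ • y ∈ Metric.sphere (0 : EuclideanSpace ℝ (Fin d)) 1 := by
    simp [norm_smul, hn]
  have e : Q y = Q (‖y‖⁻¹ • y) * ‖y‖ ^ 2 := by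
    rw [hhom]; field_simp
  change Q y₁ * ‖y‖ ^ 2 ≤ Q y ∧ Q y ≤ Q y₂ * ‖y‖ ^ 2
  rw [e]
  exact ⟨mul_le_mul_of_nonneg_right (h1 hmem) (sq_nonneg _),
    mul_le_mul_of_nonneg_right (h2 hmem) (sq_nonneg _)⟩

theorem quadForm_pos {M : Matrix (Fin d) (Fin d) ℝ} (hM : M.PosDef) {x : Pt n d}
    (hx : x ∈ regularSet n d) (i : Fin n) : 0 < quadForm M i x := by
  obtain ⟨lo, hi, hlo, -, h⟩ := exists_quadForm_bounds M hM
  have : 0 < ‖x i‖ := norm_pos_iff.2 (hx i)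
  exact lt_of_lt_of_le (by positivity) (h (x i)).1

theorem contDiffOn_quadForm_rpow {M : Matrix (Fin d) (Fin d) ℝ} (hM : M.PosDef) (i : Fin n)
    (s : ℝ) : ContDiffOn ℝ ∞ (fun x : Pt n d => quadForm M i x ^ s) (regularSet n d) :=
  (contDiff_quadForm M i).contDiffOn.rpow_const_of_ne fun _ hx => (quadForm_pos hM hx i).ne'

theorem symbolBound_coord (R : ℕ) (i : Fin n) (k : Fin d) :
    SymbolBound 1 R (fun x : Pt n d => ‖x i‖) (fun x => x i k) := by
  cases R with
  | zero => exact fun x _ => by simpa using abs_coord_le_norm (x i) k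
  | succ R =>
    refine ⟨fun x _ => by simpa using abs_coord_le_norm (x i) k, fun l => ?_⟩
    have h0 : partialDeriv l (fun x : Pt n d => x i k) = fun _ => if (i, k) = l then 1 else 0 := by
      funext x
      change fderiv ℝ (coordL (i, k)) x (unitVec l) = _
      rw [ContinuousLinearMap.fderiv, coordL_unitVec]
    rw [h0]
    refine SymbolBound.const fun x hx => ?_
    have h1 : 0 < ‖x i‖ := norm_pos_iff.2 (hx.2 i)
    have h2 := mul_le_mul_of_nonneg_left (inv_norm_le_invSum x i) h1.le
    rw [mul_inv_cancel₀ h1.ne'] at h2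
    split_ifs <;> simp <;> linarith

theorem exists_symbolBound_quadForm (M : Matrix (Fin d) (Fin d) ℝ) (R : ℕ) (i : Fin n) :
    ∃ C, SymbolBound C R (fun x : Pt n d => ‖x i‖ ^ 2) (quadForm M i) := by
  have e : (quadForm M i : Pt n d → ℝ) = fun x => ∑ k, ∑ l, x i k * (M k l * x i l) :=
    funext (quadForm_eq_sum M i)
  have hc : ∀ k, ContDiffOn ℝ ∞ (fun x : Pt n d => x i k) (regularSet n d) := fun k =>
    (contDiff_coord (i, k)).contDiffOn
  rw [e]
  refine SymbolBound.exists_sum _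
    (fun k _ => ContDiffOn.sum fun l _ => (hc k).mul (contDiffOn_const.mul (hc l))) fun k _ =>
    SymbolBound.exists_sum _
      (fun l _ => (hc k).mul (contDiffOn_const.mul (hc l))) fun l _ => ?_
  have h1 : SymbolBound |M k l| R (fun _ : Pt n d => 1) (fun _ => M k l) :=
    SymbolBound.const (by simp)
  have h2 := SymbolBound.mul (hc k) (contDiffOn_const.mul (hc l)) (symbolBound_coord R i k)
    (SymbolBound.mul contDiffOn_const (hc l) h1 (symbolBound_coord R i l))
  exact ⟨_, h2.mono (C' := 2 ^ R * (1 * (2 ^ R * (|M k l| * 1)))) fun x _ =>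
    le_of_eq (by ring)⟩

/-- By induction on `R`, for all exponents at once, from `∂(q ^ s) = s q ^ (s - 1) ∂q`. -/
theorem exists_symbolBound_quadForm_rpow {M : Matrix (Fin d) (Fin d) ℝ} (hM : M.PosDef) (R : ℕ)
    (i : Fin n) (s : ℝ) :
    ∃ C, SymbolBound C R (fun x : Pt n d => ‖x i‖ ^ (2 * s)) (fun x => quadForm M i x ^ s) := by
  have base : ∀ s : ℝ, ∃ C : ℝ, ∀ x ∈ cube n d ∩ regularSet n d,
      ‖quadForm M i x ^ s‖ ≤ C * ‖x i‖ ^ (2 * s) := by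
    intro s
    obtain ⟨lo, hi, hlo, hhi, h⟩ := exists_quadForm_bounds M hM
    refine ⟨lo ^ s + hi ^ s, fun x hx => ?_⟩
    have hx0 : 0 < ‖x i‖ := norm_pos_iff.2 (hx.2 i)
    have hq := quadForm_pos hM hx.2 i
    have hb : lo * ‖x i‖ ^ 2 ≤ quadForm M i x ∧ quadForm M i x ≤ hi * ‖x i‖ ^ 2 := h (x i)
    have e : ∀ t : ℝ, 0 < t → (t * ‖x i‖ ^ 2) ^ s = t ^ s * ‖x i‖ ^ (2 * s) := fun t ht => by
      rw [Real.mul_rpow ht.le (sq_nonneg _), ← Real.rpow_natCast, ← Real.rpow_mul hx0.le]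
      norm_num
    rw [Real.norm_of_nonneg (Real.rpow_nonneg hq.le s), add_mul, ← e lo hlo, ← e hi hhi]
    have p1 : 0 ≤ (lo * ‖x i‖ ^ 2) ^ s := by positivity
    have p2 : 0 ≤ (hi * ‖x i‖ ^ 2) ^ s := by positivity
    rcases le_total 0 s with hs | hs
    · have := Real.rpow_le_rpow hq.le hb.2 hs
      linarith
    · have := Real.rpow_le_rpow_of_nonpos (by positivity) hb.1 hs
      linarith
  induction R generalizing s with
  | zero => exact base s
  | succ R ih =>
    obtain ⟨C₀, h0⟩ := base s
    obtain ⟨C₁, h1⟩ := ih (s - 1)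
    obtain ⟨C₂, h2⟩ := exists_symbolBound_quadForm (n := n) M (R + 1) i
    have hs : SymbolBound |s| R (fun _ : Pt n d => 1) (fun _ => s) :=
      SymbolBound.const (by simp)
    set C₃ : ℝ := 2 ^ R * (|s| * (2 ^ R * (C₁ * C₂)))
    have hC : ∀ x ∈ cube n d ∩ regularSet n d, 0 ≤ ‖x i‖ ^ (2 * s) := fun x hx => by positivity
    refine ⟨max C₀ C₃, fun x hx => (h0 x hx).trans
      (mul_le_mul_of_nonneg_right (le_max_left _ _) (hC x hx)), fun l => ?_⟩
    have hq : ContDiffOn ℝ ∞ (quadForm M i) (regularSet n d) := (contDiff_quadForm M i).contDiffOn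
    have hq' := contDiffOn_partialDeriv isOpen_regularSet hq l
    have hr := contDiffOn_quadForm_rpow (n := n) hM i (s - 1)
    have h3 := SymbolBound.mul contDiffOn_const (hr.mul hq') hs (SymbolBound.mul hr hq' h1 (h2.2 l))
    refine (h3.congr fun x hx => ?_).mono fun x hx => ?_
    · have hd := ((contDiff_quadForm M i).differentiable (by simp) x).hasFDerivAt
      have h4 := hd.rpow_const (p := s) (Or.inl (quadForm_pos hM hx i).ne')
      simp only [partialDeriv]
      rw [h4.fderiv]
      simp only [smul_apply, smul_eq_mul]
      ring
    · have hx0 : 0 < ‖x i‖ := norm_pos_iff.2 (hx.2 i)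
      have e : ‖x i‖ ^ (2 * (s - 1)) * ‖x i‖ ^ 2 = ‖x i‖ ^ (2 * s) := by
        rw [← Real.rpow_natCast, ← Real.rpow_add hx0]
        congr 1
        push_cast
        ring
      have e2 : (1 : ℝ) * (‖x i‖ ^ (2 * (s - 1)) * (‖x i‖ ^ 2 * invSum x))
          = ‖x i‖ ^ (2 * s) * invSum x := by
        rw [← e]; ring
      rw [e2]
      exact mul_le_mul_of_nonneg_right (le_max_right _ _)
        (mul_nonneg (hC x hx) (invSum_nonneg x))

theorem fractionalForm_eqOn {M : Matrix (Fin d) (Fin d) ℝ} (hM : M.PosDef) (p : Fin n → ℝ)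
    (f : Fin n → Pt n d → 𝕜) :
    Set.EqOn (fun x => ∏ i, f i x * ((quadForm M i x ^ (-p i) : ℝ) : 𝕜)) (fractionalForm M p f)
      (regularSet n d) := by
  intro x hx
  refine Finset.prod_congr rfl fun i _ => ?_
  rw [Real.rpow_neg (quadForm_pos hM hx i).le, RCLike.ofReal_inv, div_eq_mul_inv]
  rfl

theorem contDiffOn_ofReal_quadForm_rpow {M : Matrix (Fin d) (Fin d) ℝ} (hM : M.PosDef)
    (i : Fin n) (s : ℝ) :
    ContDiffOn ℝ ∞ (fun x : Pt n d => ((quadForm M i x ^ s : ℝ) : 𝕜)) (regularSet n d) :=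
  (RCLike.ofRealCLM (K := 𝕜)).contDiff.comp_contDiffOn (contDiffOn_quadForm_rpow hM i s)

theorem contDiffOn_fractionalForm {M : Matrix (Fin d) (Fin d) ℝ} (hM : M.PosDef) (p : Fin n → ℝ)
    {f : Fin n → Pt n d → 𝕜} (hf : ∀ i, ContDiff ℝ ∞ (f i)) :
    ContDiffOn ℝ ∞ (fractionalForm M p f) (regularSet n d) :=
  (contDiffOn_prod fun i _ => (hf i).contDiffOn.mul
    (contDiffOn_ofReal_quadForm_rpow hM i (-p i))).congr fun _ hx =>
      (fractionalForm_eqOn hM p f hx).symm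

/-- The basic estimate for the derivatives of the fractional form: the symbol bounds of the
numerators and of the powers of the quadratic forms multiply. -/
theorem exists_multiDeriv_fractionalForm_le {M : Matrix (Fin d) (Fin d) ℝ} (hM : M.PosDef)
    (a : Fin n → ℕ) (p : Fin n → ℝ) (R : ℕ) (K : ℝ) :
    ∃ C : ℝ, 0 ≤ C ∧ ∀ f : Fin n → Pt n d → 𝕜, (∀ i, ContDiff ℝ ∞ (f i)) →
      (∀ i, SymbolBound K R (fun x => ‖x i‖ ^ a i) (f i)) →
      ∀ β : MultiIndex n d, order β ≤ R → ∀ x ∈ cube n d ∩ regularSet n d,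
        ‖multiDeriv β (fractionalForm M p f) x‖
          ≤ C * ((∏ i, ‖x i‖ ^ gam a p i) * invSum x ^ order β) := by
  choose C hC using fun i : Fin n => exists_symbolBound_quadForm_rpow (n := n) hM R i (-p i)
  refine ⟨|(2 ^ R) ^ (Finset.univ : Finset (Fin n)).card * ∏ i, 2 ^ R * (K * C i)|, abs_nonneg _,
    fun f hf hK β hβ x hx => ?_⟩
  have h1 := SymbolBound.prod Finset.univ
    (fun i _ => (hf i).contDiffOn.mul (contDiffOn_ofReal_quadForm_rpow (𝕜 := 𝕜) hM i (-p i)))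
    (fun i _ => SymbolBound.mul (hf i).contDiffOn
      (contDiffOn_ofReal_quadForm_rpow (𝕜 := 𝕜) hM i (-p i)) (hK i)
      ((hC i).ofReal (contDiffOn_quadForm_rpow hM i (-p i))))
  refine ((h1.congr (fractionalForm_eqOn hM p f)).multiDeriv_le
    (contDiffOn_fractionalForm hM p hf) β hβ x hx).trans ?_
  have e : ∏ i, ‖x i‖ ^ a i * ‖x i‖ ^ (2 * -p i) = ∏ i, ‖x i‖ ^ gam a p i :=
    Finset.prod_congr rfl fun i _ => by
      have hx0 : 0 < ‖x i‖ := norm_pos_iff.2 (hx.2 i)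
      rw [← Real.rpow_natCast, ← Real.rpow_add hx0, gam]
      congr 1; ring
  rw [e]
  exact mul_le_mul_of_nonneg_right (le_abs_self _)
    (mul_nonneg (Finset.prod_nonneg fun i _ => by positivity)
      (pow_nonneg (invSum_nonneg x) _))

/-- The derivative bounds give a symbol bound with weight `|xᵢ|^(aᵢ)`. Beyond the order `aᵢ` a
constant bound is enough, since `|xᵢ|` is bounded on the cube and hence `|xᵢ|^(aᵢ - |β|)` is bounded
below. -/
theorem DerivBound.symbolBound (hd : 0 < d) {a : Fin n → ℕ} {r K : ℝ} {f : Fin n → Pt n d → 𝕜}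
    (hf : ∀ i, ContDiff ℝ ∞ (f i)) (h : DerivBound a r f K) (i : Fin n) :
    SymbolBound (max K 0 * (d : ℝ) ^ ⌈r⌉₊) ⌈r⌉₊ (fun x => ‖x i‖ ^ a i) (f i) := by
  refine SymbolBound.of_multiDeriv_le (hf i).contDiffOn fun β hβ x hx => ?_
  have hx0 : 0 < ‖x i‖ := norm_pos_iff.2 (hx.2 i)
  have hd1 : (1 : ℝ) ≤ d := by exact_mod_cast hd
  have hσ : 1 ≤ ‖x i‖ * invSum x := by
    have := mul_le_mul_of_nonneg_left (inv_norm_le_invSum x i) hx0.le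
    rwa [mul_inv_cancel₀ hx0.ne'] at this
  have hdR : (1 : ℝ) ≤ (d : ℝ) ^ ⌈r⌉₊ := one_le_pow₀ hd1
  have hσ0 := invSum_nonneg x
  have hK : 0 ≤ max K 0 := le_max_right _ _
  rcases le_or_gt (order β) (a i) with hle | hgt
  · calc ‖multiDeriv β (f i) x‖ ≤ K * ‖x i‖ ^ (a i - order β) := h.low i β hle x hx.1
      _ ≤ max K 0 * ‖x i‖ ^ (a i - order β) :=
        mul_le_mul_of_nonneg_right (le_max_left _ _) (by positivity)
      _ ≤ max K 0 * (d : ℝ) ^ ⌈r⌉₊ * (‖x i‖ ^ (a i - order β) * 1) := by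
        rw [mul_one]
        refine mul_le_mul_of_nonneg_right ?_ (by positivity)
        nlinarith
      _ ≤ max K 0 * (d : ℝ) ^ ⌈r⌉₊ *
          (‖x i‖ ^ (a i - order β) * (‖x i‖ * invSum x) ^ order β) := by
        have := one_le_pow₀ hσ (n := order β)
        gcongr
      _ = _ := by
        rw [mul_pow, ← mul_assoc (‖x i‖ ^ (a i - order β)), ← pow_add, Nat.sub_add_cancel hle]
  · have hxd := norm_le_of_mem_cube hx.1 i
    have h1 : (1 : ℝ) ≤ (d : ℝ) ^ ⌈r⌉₊ * (‖x i‖ ^ a i * invSum x ^ order β) := by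
      calc (1 : ℝ) ≤ (‖x i‖ * invSum x) ^ a i := one_le_pow₀ hσ
        _ ≤ (‖x i‖ * invSum x) ^ a i * (d * invSum x) ^ (order β - a i) := by
          have h2 : 1 ≤ d * invSum x := hσ.trans (mul_le_mul_of_nonneg_right hxd hσ0)
          exact le_mul_of_one_le_right (by positivity) (one_le_pow₀ h2)
        _ = (d : ℝ) ^ (order β - a i) * (‖x i‖ ^ a i * invSum x ^ order β) := by
          have e : invSum x ^ order β = invSum x ^ (order β - a i) * invSum x ^ a i := by
            rw [← pow_add, Nat.sub_add_cancel hgt.le]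
          rw [mul_pow, mul_pow, e]
          ring
        _ ≤ _ := by
          refine mul_le_mul_of_nonneg_right (pow_le_pow_right₀ hd1 (by omega)) (by positivity)
    calc ‖multiDeriv β (f i) x‖ ≤ K := h.high i β hgt hβ x hx.1
      _ ≤ max K 0 * 1 := by rw [mul_one]; exact le_max_left _ _
      _ ≤ max K 0 * ((d : ℝ) ^ ⌈r⌉₊ * (‖x i‖ ^ a i * invSum x ^ order β)) :=
        mul_le_mul_of_nonneg_left h1 hK
      _ = _ := by ring

end FractionalForm

/-! ### Vanishing order of the numerators -/

section Vanishing

variable {𝕜 : Type*} [RCLike 𝕜] {n d : ℕ}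

/-- A Landau-Kolmogorov inequality on `[0, 1]`: the first derivative is controlled by the function
and a higher derivative. -/
theorem exists_norm_deriv_le (a : ℕ) :
    ∃ C : ℝ, 0 ≤ C ∧ ∀ ψ : ℝ → 𝕜, ContDiff ℝ ∞ ψ → ∀ A B : ℝ,
      (∀ t ∈ Set.Icc (0 : ℝ) 1, ‖ψ t‖ ≤ A) →
      (∀ t ∈ Set.Icc (0 : ℝ) 1, ‖iteratedDeriv (a + 1) ψ t‖ ≤ B) →
      ∀ t ∈ Set.Icc (0 : ℝ) 1, ‖deriv ψ t‖ ≤ C * (A + B) := by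
  induction a with
  | zero =>
    refine ⟨1, zero_le_one, fun ψ _ A B hA hB t ht => ?_⟩
    have h1 := hB t ht
    rw [zero_add, iteratedDeriv_one] at h1
    have h2 := (norm_nonneg _).trans (hA t ht)
    linarith
  | succ a ih =>
    obtain ⟨C, hC, h⟩ := ih
    refine ⟨8 * (C + 1), by positivity, fun ψ hψ A B hA hB t ht => ?_⟩
    have hψ' : ContDiff ℝ ∞ (deriv ψ) := (contDiff_infty_iff_deriv.1 hψ).2
    have hd : Differentiable ℝ ψ := (contDiff_infty_iff_deriv.1 hψ).1
    have hd' : Differentiable ℝ (deriv ψ) := (contDiff_infty_iff_deriv.1 hψ').1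
    -- the supremum `S` of the first derivative is attained at `t₀`
    obtain ⟨t₀, ht₀, hmax⟩ := isCompact_Icc.exists_isMaxOn (Set.nonempty_Icc.2 zero_le_one)
      (hψ'.continuous.norm.continuousOn (s := Set.Icc (0 : ℝ) 1))
    set S := ‖deriv ψ t₀‖
    have hS : ∀ t ∈ Set.Icc (0 : ℝ) 1, ‖deriv ψ t‖ ≤ S := fun t ht => hmax ht
    have h2 : ∀ t ∈ Set.Icc (0 : ℝ) 1, ‖deriv (deriv ψ) t‖ ≤ C * (S + B) :=
      h (deriv ψ) hψ' S B hS fun t ht => by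
        rw [← iteratedDeriv_succ']; exact hB t ht
    have hA0 : 0 ≤ A := (norm_nonneg _).trans (hA t ht)
    have hB0 : 0 ≤ B := (norm_nonneg _).trans (hB t ht)
    have hS0 : 0 ≤ S := norm_nonneg _
    -- with this `ε`, the term `C ε S` coming from the second derivative is absorbed into `S`
    set ε : ℝ := 1 / (2 * (C + 1)) with hε
    have hε0 : 0 < ε := by positivity
    have hε1 : ε ≤ 1 / 2 := by
      rw [hε]; apply one_div_le_one_div_of_le <;> linarith
    have hCε : C * ε ≤ 1 / 2 := by
      rw [hε, mul_one_div, div_le_iff₀ (by positivity)]; linarith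
    obtain ⟨t₁, ht₁, habs⟩ : ∃ t₁ ∈ Set.Icc (0 : ℝ) 1, |t₁ - t₀| = ε := by
      rcases le_total t₀ (1 / 2) with h0 | h0
      · refine ⟨t₀ + ε, ⟨by linarith [ht₀.1], by linarith⟩, ?_⟩
        rw [add_sub_cancel_left, abs_of_pos hε0]
      · refine ⟨t₀ - ε, ⟨by linarith, by linarith [ht₀.2]⟩, ?_⟩
        rw [sub_sub_cancel_left, abs_neg, abs_of_pos hε0]
    set s : Set ℝ := Set.Icc (0 : ℝ) 1 ∩ Metric.closedBall t₀ ε with hs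
    have hsc : Convex ℝ s := (convex_Icc 0 1).inter (convex_closedBall t₀ ε)
    have m0 : t₀ ∈ s := ⟨ht₀, Metric.mem_closedBall_self hε0.le⟩
    have m1 : t₁ ∈ s := ⟨ht₁, by rw [Metric.mem_closedBall, Real.dist_eq, habs]⟩
    have h3 : ∀ t ∈ s, ‖deriv ψ t - deriv ψ t₀‖ ≤ C * (S + B) * ε := fun t ht => by
      have h4 := hsc.norm_image_sub_le_of_norm_deriv_le (f := deriv ψ) (fun x _ => hd' x)
        (fun x hx => h2 x hx.1) m0 ht
      refine h4.trans (mul_le_mul_of_nonneg_left ?_ (by positivity))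
      rw [Real.norm_eq_abs, ← Real.dist_eq]
      exact ht.2
    have hderiv : ∀ t, HasDerivAt (fun t : ℝ => ψ t - t • deriv ψ t₀)
        (deriv ψ t - deriv ψ t₀) t := fun t => by
      have h := (hd t).hasDerivAt.sub ((hasDerivAt_id t).smul_const (deriv ψ t₀))
      rw [one_smul] at h
      exact h
    have h5 := hsc.norm_image_sub_le_of_norm_deriv_le
      (f := fun t : ℝ => ψ t - t • deriv ψ t₀) (fun x _ => (hderiv x).differentiableAt)
      (fun x hx => by rw [(hderiv x).deriv]; exact h3 x hx) m0 m1
    rw [Real.norm_eq_abs, habs] at h5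
    have h6 : ε * S ≤ 2 * A + C * (S + B) * ε * ε := by
      have e : (t₁ - t₀) • deriv ψ t₀ = ψ t₁ - ψ t₀
          - ((ψ t₁ - t₁ • deriv ψ t₀) - (ψ t₀ - t₀ • deriv ψ t₀)) := by
        rw [sub_smul]; abel
      calc ε * S = ‖(t₁ - t₀) • deriv ψ t₀‖ := by rw [norm_smul, Real.norm_eq_abs, habs]
        _ ≤ ‖ψ t₁‖ + ‖ψ t₀‖ + C * (S + B) * ε * ε := by
          rw [e]
          exact (norm_sub_le _ _).trans (add_le_add (norm_sub_le _ _) h5)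
        _ ≤ _ := by linarith [hA t₀ ht₀, hA t₁ ht₁]
    have h7 : S ≤ 2 * A / ε + C * ε * (S + B) := by
      have : S = (ε * S) / ε := by field_simp
      rw [this]
      calc ε * S / ε ≤ (2 * A + C * (S + B) * ε * ε) / ε := by gcongr
        _ = 2 * A / ε + C * ε * (S + B) := by field_simp
        _ = _ := by rw [← this]
    have h8 : 2 * A / ε = 4 * (C + 1) * A := by rw [hε]; field_simp; ring
    have h9 : C * ε * (S + B) ≤ 1 / 2 * (S + B) :=
      mul_le_mul_of_nonneg_right hCε (by positivity)
    rw [h8] at h7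
    have h10 : S ≤ 8 * (C + 1) * (A + B) := by nlinarith [mul_nonneg hC hB0]
    exact (hS t ht).trans h10

theorem norm_unitVec (l : Fin n × Fin d) : ‖(unitVec l : Pt n d)‖ = 1 := by
  rw [unitVec, Pi.norm_single]; simp

theorem contDiff_partialDeriv_iterate {h : Pt n d → 𝕜} (hh : ContDiff ℝ ∞ h)
    (l : Fin n × Fin d) (k : ℕ) : ContDiff ℝ ∞ ((partialDeriv l)^[k] h) :=
  contDiffOn_univ.1 (contDiffOn_partialDeriv_iterate isOpen_univ hh.contDiffOn l k)

theorem iteratedDeriv_comp_line {h : Pt n d → 𝕜} (hh : ContDiff ℝ ∞ h) (l : Fin n × Fin d)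
    (x : Pt n d) (δ : ℝ) (k : ℕ) :
    iteratedDeriv k (fun t : ℝ => h (x + (t * δ) • unitVec l))
      = fun t : ℝ => δ ^ k • (partialDeriv l)^[k] h (x + (t * δ) • unitVec l) := by
  induction k with
  | zero => simp
  | succ k ih =>
    rw [iteratedDeriv_succ, ih]
    funext t
    have h1 : HasDerivAt (fun t : ℝ => x + (t * δ) • (unitVec l : Pt n d)) (δ • unitVec l) t := by
      simpa using (((hasDerivAt_id t).mul_const δ).smul_const (unitVec l : Pt n d)).const_add x
    have h2 := ((contDiff_partialDeriv_iterate hh l k).differentiable (by simp)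
      (x + (t * δ) • unitVec l)).hasFDerivAt.comp_hasDerivAt t h1
    refine (h2.const_smul (δ ^ k)).deriv.trans ?_
    rw [map_smul, smul_smul, ← pow_succ,
      Function.iterate_succ_apply']
    rfl

/-- Differentiation lowers the order of vanishing along `xᵢ = 0` by at most one: apply the
Landau-Kolmogorov inequality to the segment of length about `|xᵢ|` in the direction of the
derivative. -/
theorem partialDeriv_isBigO {h : Pt n d → 𝕜} (hh : ContDiff ℝ ∞ h) (i : Fin n) {y : Pt n d}
    (hy : y i = 0) {a : ℕ} (hO : h =O[𝓝 y] fun x => ‖x i‖ ^ (a + 1)) (l : Fin n × Fin d) :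
    partialDeriv l h =O[𝓝 y] fun x => ‖x i‖ ^ a := by
  obtain ⟨A, hA0, hA⟩ := hO.exists_pos
  rw [IsBigOWith] at hA
  obtain ⟨ε, hε, hball⟩ := Metric.eventually_nhds_iff_ball.1 hA
  obtain ⟨B, hB⟩ := (isCompact_closedBall y ε).exists_bound_of_continuousOn
    (contDiff_partialDeriv_iterate hh l (a + 1)).continuous.continuousOn
  obtain ⟨C, hC, hL⟩ := exists_norm_deriv_le (𝕜 := 𝕜) a
  refine IsBigO.of_bound (C * (A * 2 ^ (a + 1) + B)) ?_
  filter_upwards [Metric.ball_mem_nhds y (half_pos hε)] with x hx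
  have hxi : ‖x i‖ < ε / 2 := by
    have h1 := norm_le_pi_norm (x - y) i
    rw [Pi.sub_apply, hy, sub_zero] at h1
    rw [Metric.mem_ball, dist_eq_norm] at hx
    exact h1.trans_lt hx
  rw [Real.norm_of_nonneg (by positivity)]
  -- the step size `δ` slightly above `|xᵢ|`, to include points with `xᵢ = 0`
  have key : ∀ δ ∈ Set.Ioo ‖x i‖ (ε / 2),
      ‖partialDeriv l h x‖ ≤ C * (A * 2 ^ (a + 1) + B) * δ ^ a := by
    intro δ hδ
    have hδ0 : 0 < δ := (norm_nonneg _).trans_lt hδ.1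
    have hstep : ∀ t ∈ Set.Icc (0 : ℝ) 1, ‖(t * δ) • (unitVec l : Pt n d)‖ ≤ δ := by
      intro t ht
      rw [norm_smul, norm_unitVec, mul_one, Real.norm_of_nonneg (mul_nonneg ht.1 hδ0.le)]
      nlinarith [ht.2]
    have hmem : ∀ t ∈ Set.Icc (0 : ℝ) 1, x + (t * δ) • unitVec l ∈ Metric.ball y ε := by
      intro t ht
      rw [Metric.mem_ball, dist_eq_norm, add_sub_right_comm]
      refine (norm_add_le _ _).trans_lt ?_
      rw [Metric.mem_ball, dist_eq_norm] at hx
      linarith [hstep t ht, hδ.2]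
    have hψ : ContDiff ℝ ∞ fun t : ℝ => h (x + (t * δ) • unitVec l) :=
      hh.comp (contDiff_const.add ((contDiff_id.mul contDiff_const).smul contDiff_const))
    have h1 := hL _ hψ (A * (2 * δ) ^ (a + 1)) (δ ^ (a + 1) * B) (fun t ht => by
        refine (hball _ (hmem t ht)).trans (mul_le_mul_of_nonneg_left ?_ hA0.le)
        rw [Real.norm_of_nonneg (by positivity)]
        refine pow_le_pow_left₀ (norm_nonneg _) ?_ _
        have h2 := norm_le_pi_norm ((t * δ) • (unitVec l : Pt n d)) i
        have h3 := norm_add_le (x i) (((t * δ) • (unitVec l : Pt n d)) i)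
        rw [Pi.add_apply]
        linarith [hstep t ht, hδ.1]) (fun t ht => by
        rw [iteratedDeriv_comp_line hh, norm_smul, Real.norm_of_nonneg (by positivity)]
        exact mul_le_mul_of_nonneg_left (hB _ (Metric.ball_subset_closedBall (hmem t ht)))
          (by positivity)) 0 (by simp)
    have h4 := congrFun (iteratedDeriv_comp_line hh l x δ 1) 0
    rw [iteratedDeriv_one] at h4
    rw [h4] at h1
    simp only [zero_mul, zero_smul, add_zero, Function.iterate_one, pow_one, norm_smul] at h1
    rw [Real.norm_of_nonneg hδ0.le] at h1
    have h5 : C * (A * (2 * δ) ^ (a + 1) + δ ^ (a + 1) * B)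
        = δ * (C * (A * 2 ^ (a + 1) + B) * δ ^ a) := by
      rw [mul_pow]; ring
    rw [h5] at h1
    exact le_of_mul_le_mul_left h1 hδ0
  have hlim : Tendsto (fun δ : ℝ => C * (A * 2 ^ (a + 1) + B) * δ ^ a) (𝓝[>] ‖x i‖)
      (𝓝 (C * (A * 2 ^ (a + 1) + B) * ‖x i‖ ^ a)) :=
    ((continuous_const.mul (continuous_pow a)).tendsto _).mono_left nhdsWithin_le_nhds
  exact ge_of_tendsto hlim (by
    filter_upwards [Ioo_mem_nhdsGT hxi] with δ hδ using key δ hδ)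

theorem multiDeriv_isBigO {h : Pt n d → 𝕜} (hh : ContDiff ℝ ∞ h) (i : Fin n) {y : Pt n d}
    (hy : y i = 0) {a : ℕ} (hO : h =O[𝓝 y] fun x => ‖x i‖ ^ a) (α : MultiIndex n d)
    (hα : order α ≤ a) : multiDeriv α h =O[𝓝 y] fun x => ‖x i‖ ^ (a - order α) := by
  induction hs : order α generalizing h a α with
  | zero =>
    rw [eq_zero_of_order_eq_zero hs, multiDeriv_zero]
    exact hO
  | succ s ih =>
    obtain ⟨α', l, h1, rfl⟩ := exists_eq_add_single hs
    have e := multiDeriv_add_single isOpen_univ hh.contDiffOn α' l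
    rw [Set.eqOn_univ] at e
    obtain ⟨b, rfl⟩ : ∃ b, a = b + 1 := ⟨a - 1, by omega⟩
    have h2 := ih (contDiffOn_univ.1 (contDiffOn_partialDeriv isOpen_univ hh.contDiffOn l))
      (partialDeriv_isBigO hh i hy hO l) α' (by omega) h1
    rw [e]
    simpa only [Nat.add_sub_add_right] using h2

theorem exists_norm_le_of_isBigO {F : Pt n d → 𝕜} (hF : Continuous F) (i : Fin n) (k : ℕ)
    (hO : ∀ y ∈ cube n d, y i = 0 → F =O[𝓝 y] fun x => ‖x i‖ ^ k) :
    ∃ K, ∀ x ∈ cube n d, ‖F x‖ ≤ K * ‖x i‖ ^ k := by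
  have hloc : ∀ y ∈ cube n d, F =O[𝓝 y] fun x => ‖x i‖ ^ k := by
    intro y hy
    by_cases h0 : y i = 0
    · exact hO y hy h0
    · have hg : Continuous fun x : Pt n d => ‖x i‖ ^ k := ((continuous_apply i).norm).pow k
      have h1 : F =O[𝓝 y] fun _ => (1 : ℝ) := hF.continuousAt.isBigO_one ℝ
      have h2 : (fun _ => (1 : ℝ)) =O[𝓝 y] fun x : Pt n d => ‖x i‖ ^ k :=
        isBigO_const_left_iff_pos_le_norm one_ne_zero |>.2 ⟨‖y i‖ ^ k / 2, by positivity, by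
          have h3 : ‖y i‖ ^ k / 2 < ‖y i‖ ^ k := half_lt_self (by positivity)
          filter_upwards [hg.continuousAt.eventually (lt_mem_nhds h3)] with x hx
          rw [Real.norm_of_nonneg (by positivity)]
          exact hx.le⟩
      exact h1.trans h2
  refine isCompact_cube.induction_on
    (p := fun s => ∃ K, ∀ x ∈ s, ‖F x‖ ≤ K * ‖x i‖ ^ k) ⟨0, by simp⟩ ?_ ?_ ?_
  · rintro s t hst ⟨K, hK⟩
    exact ⟨K, fun x hx => hK x (hst hx)⟩
  · rintro s t ⟨K, hK⟩ ⟨K', hK'⟩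
    refine ⟨max K K', fun x hx => ?_⟩
    rcases hx with hx | hx
    · exact (hK x hx).trans (mul_le_mul_of_nonneg_right (le_max_left _ _) (by positivity))
    · exact (hK' x hx).trans (mul_le_mul_of_nonneg_right (le_max_right _ _) (by positivity))
  · intro y hy
    obtain ⟨K, hK⟩ := (hloc y hy).bound
    refine ⟨_, mem_nhdsWithin_of_mem_nhds hK, K, fun x hx => ?_⟩
    simpa [Real.norm_of_nonneg] using hx

theorem Admissible.exists_derivBound {a : Fin n → ℕ} {f : Fin n → Pt n d → 𝕜}
    (hf : Admissible a f) (r : ℝ) : ∃ K, DerivBound a r f K := by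
  have hcont : ∀ (i : Fin n) (α : MultiIndex n d), Continuous (multiDeriv α (f i)) := fun i α =>
    (contDiffOn_univ.1
      (contDiffOn_multiDeriv isOpen_univ (hf.smooth i).contDiffOn α)).continuous
  have h : ∀ (i : Fin n) (α : MultiIndex n d), ∃ K, 0 ≤ K ∧
      (order α ≤ a i → ∀ x ∈ cube n d, ‖multiDeriv α (f i) x‖ ≤ K * ‖x i‖ ^ (a i - order α)) ∧
      ∀ x ∈ cube n d, ‖multiDeriv α (f i) x‖ ≤ K := by
    intro i α
    obtain ⟨K₁, h1⟩ := isCompact_cube.exists_bound_of_continuousOn (hcont i α).continuousOn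
    by_cases hα : order α ≤ a i
    · obtain ⟨K₂, h2⟩ := exists_norm_le_of_isBigO (hcont i α) i (a i - order α)
        fun y hy hy0 => multiDeriv_isBigO (hf.smooth i) i hy0 (hf.isBigO i y hy hy0) α hα
      refine ⟨max 0 (max K₁ K₂), le_max_left _ _, fun _ x hx => (h2 x hx).trans ?_,
        fun x hx => (h1 x hx).trans ?_⟩
      · exact mul_le_mul_of_nonneg_right ((le_max_right _ _).trans (le_max_right _ _))
          (by positivity)
      · exact (le_max_left _ _).trans (le_max_right _ _)
    · exact ⟨max 0 K₁, le_max_left _ _, fun h => absurd h hα,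
        fun x hx => (h1 x hx).trans (le_max_right _ _)⟩
  choose K hK0 hK1 hK2 using h
  set S : Finset (MultiIndex n d) :=
    Fintype.piFinset fun _ => Finset.range (⌈r⌉₊ + (∑ i, a i) + 1)
  have hmem : ∀ α : MultiIndex n d, order α ≤ ⌈r⌉₊ + ∑ i, a i → α ∈ S := by
    intro α hα
    refine Fintype.mem_piFinset.2 fun l => Finset.mem_range.2 ?_
    have : α l ≤ order α := Finset.single_le_sum (f := α) (fun _ _ => Nat.zero_le _)
      (Finset.mem_univ l)
    omega
  have hle : ∀ i, ∀ α : MultiIndex n d, order α ≤ ⌈r⌉₊ + ∑ i, a i →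
      K i α ≤ ∑ i, ∑ α ∈ S, K i α := fun i α hα =>
    (Finset.single_le_sum (f := K i) (fun α _ => hK0 i α) (hmem α hα)).trans
      (Finset.single_le_sum (f := fun i => ∑ α ∈ S, K i α)
        (fun i _ => Finset.sum_nonneg fun α _ => hK0 i α) (Finset.mem_univ i))
  refine ⟨∑ i, ∑ α ∈ S, K i α, ⟨fun i α hα x hx => ?_, fun i α _ hα x hx => ?_⟩⟩
  · have : a i ≤ ∑ i, a i := Finset.single_le_sum (fun _ _ => Nat.zero_le _) (Finset.mem_univ i)
    exact (hK1 i α hα x hx).trans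
      (mul_le_mul_of_nonneg_right (hle i α (by omega)) (by positivity))
  · exact (hK2 i α x hx).trans (hle i α (by omega))

end Vanishing

/-! ### Sums over the cells of a block -/

section Counting

variable {d : ℕ}

/-- The distance of the centre of the `t`-th mesh interval to `0`, in units of half a mesh
width. -/
def offCenter {m : ℕ} (t : Fin m) : ℕ := (2 * ((t : ℕ) : ℤ) + 1 - m).natAbs

/-- The distance of a cell of the block `[-1/2, 1/2]ᵈ` to `0`, in units of the mesh width and up to
constants. It is at least `1`. -/
def level {m : ℕ} (q : Fin d → Fin m) : ℕ := (Finset.univ.sup fun k => offCenter (q k)) + 1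

theorem offCenter_lt_level {m : ℕ} (q : Fin d → Fin m) (k : Fin d) :
    offCenter (q k) < level q :=
  Nat.lt_succ_of_le (Finset.le_sup (f := fun k => offCenter (q k)) (Finset.mem_univ k))

theorem exists_offCenter_eq (hd : 0 < d) {m : ℕ} (q : Fin d → Fin m) :
    ∃ k, offCenter (q k) + 1 = level q := by
  obtain ⟨k, -, hk⟩ := Finset.exists_mem_eq_sup Finset.univ ⟨⟨0, hd⟩, Finset.mem_univ _⟩
    fun k => offCenter (q k)
  exact ⟨k, by rw [level, hk]⟩

theorem one_le_level {m : ℕ} (q : Fin d → Fin m) : 1 ≤ level q := Nat.succ_pos _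

theorem level_le (hd : 0 < d) {m : ℕ} (q : Fin d → Fin m) : level q ≤ m := by
  obtain ⟨k, hk⟩ := exists_offCenter_eq hd q
  rw [← hk, offCenter]
  have := (q k).2
  omega

theorem card_offCenter_le (m t : ℕ) :
    (Finset.univ.filter fun x : Fin m => offCenter x ≤ t).card ≤ t + 1 := by
  rw [← Finset.card_range (t + 1)]
  refine Finset.card_le_card_of_injOn
    (fun x => ((2 * ((x : ℕ) : ℤ) + 1 - m + t) / 2).toNat) ?_ ?_
  · intro x hx
    have hx' := (Finset.mem_filter.1 hx).2
    rw [offCenter] at hx'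
    simp only [Finset.coe_range, Set.mem_Iio]
    omega
  · intro x hx y hy hxy
    have hx' := (Finset.mem_filter.1 hx).2
    have hy' := (Finset.mem_filter.1 hy).2
    rw [offCenter] at hx' hy'
    simp only at hxy
    ext
    omega

theorem card_offCenter_eq (m t : ℕ) :
    (Finset.univ.filter fun x : Fin m => offCenter x = t).card ≤ 2 := by
  refine (Finset.card_le_card_of_injOn (s := Finset.univ.filter fun x : Fin m => offCenter x = t)
    (t := ({(t : ℤ), -(t : ℤ)} : Finset ℤ))
    (fun x => 2 * ((x : ℕ) : ℤ) + 1 - m) ?_ ?_).trans Finset.card_le_two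
  · intro x hx
    have hx' := (Finset.mem_filter.1 hx).2
    rw [offCenter] at hx'
    simp only [Finset.coe_insert, Finset.coe_singleton, Set.mem_insert_iff, Set.mem_singleton_iff]
    omega
  · intro x _ y _ hxy
    simp only at hxy
    ext
    omega

/-- On a shell of given level, some coordinate attains the maximal `offCenter`, which leaves two
choices for it and at most `t + 1` choices for each of the others. -/
theorem card_level_eq (hd : 0 < d) (m t : ℕ) :
    (Finset.univ.filter fun q : Fin d → Fin m => level q = t + 1).card
      ≤ d * (2 * (t + 1) ^ (d - 1)) := by
  classical
  set S : Fin d → Finset (Fin d → Fin m) := fun k => Fintype.piFinset fun l =>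
    if l = k then Finset.univ.filter fun x : Fin m => offCenter x = t
    else Finset.univ.filter fun x : Fin m => offCenter x ≤ t with hS
  have hsub : (Finset.univ.filter fun q : Fin d → Fin m => level q = t + 1)
      ⊆ Finset.univ.biUnion S := by
    intro q hq
    rw [Finset.mem_filter] at hq
    obtain ⟨k, hk⟩ := exists_offCenter_eq hd q
    refine Finset.mem_biUnion.2 ⟨k, Finset.mem_univ k, Fintype.mem_piFinset.2 fun l => ?_⟩
    have := offCenter_lt_level q l
    split_ifs with h
    · subst h
      simp only [Finset.mem_filter, Finset.mem_univ, true_and]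
      omega
    · simp only [Finset.mem_filter, Finset.mem_univ, true_and]
      omega
  refine (Finset.card_le_card hsub).trans (Finset.card_biUnion_le.trans ?_)
  have hc : ∀ k ∈ (Finset.univ : Finset (Fin d)), (S k).card ≤ 2 * (t + 1) ^ (d - 1) := by
    intro k _
    rw [hS, Fintype.card_piFinset, ← Finset.mul_prod_erase _ _ (Finset.mem_univ k)]
    refine Nat.mul_le_mul (by simpa using card_offCenter_eq m t) ?_
    have : (Finset.univ.erase k).card = d - 1 := by simp
    rw [← this, ← Finset.prod_const]
    refine Finset.prod_le_prod' fun l hl => ?_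
    rw [if_neg (Finset.ne_of_mem_erase hl)]
    exact card_offCenter_le m t
  refine (Finset.sum_le_sum hc).trans (le_of_eq ?_)
  simp

theorem sum_level_le (hd : 0 < d) (m : ℕ) {F : ℕ → ℝ} (hF : ∀ t, 0 ≤ F t) :
    ∑ q : Fin d → Fin m, F (level q)
      ≤ (2 * d : ℕ) * ∑ t ∈ Finset.range m, ((t + 1 : ℕ) : ℝ) ^ (d - 1) * F (t + 1) := by
  have hmaps : ∀ q ∈ (Finset.univ : Finset (Fin d → Fin m)), level q - 1 ∈ Finset.range m := by
    intro q _
    have h1 := level_le hd q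
    have h2 := one_le_level q
    rw [Finset.mem_range]; omega
  rw [← Finset.sum_fiberwise_of_maps_to hmaps, Finset.mul_sum]
  refine Finset.sum_le_sum fun t _ => ?_
  have e : (Finset.univ.filter fun q : Fin d → Fin m => level q - 1 = t)
      = Finset.univ.filter fun q : Fin d → Fin m => level q = t + 1 := by
    refine Finset.filter_congr fun q _ => ?_
    have h2 := one_le_level q
    omega
  rw [e, Finset.sum_congr rfl fun q hq => by rw [(Finset.mem_filter.1 hq).2], Finset.sum_const,
    nsmul_eq_mul, ← mul_assoc]
  refine mul_le_mul_of_nonneg_right ?_ (hF _)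
  have := card_level_eq hd m t
  calc _ ≤ ((d * (2 * (t + 1) ^ (d - 1)) : ℕ) : ℝ) := by exact_mod_cast this
    _ = _ := by push_cast; ring

theorem sum_rpow_sub_one_le {δ : ℝ} (hδ : 0 < δ) (m : ℕ) :
    ∑ t ∈ Finset.range m, ((t + 1 : ℕ) : ℝ) ^ (δ - 1) ≤ max 1 δ⁻¹ * (m : ℝ) ^ δ := by
  rcases le_total 1 δ with h1 | h1
  · have h2 : ∑ t ∈ Finset.range m, ((t + 1 : ℕ) : ℝ) ^ (δ - 1) ≤ (m : ℝ) ^ δ := by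
      rcases Nat.eq_zero_or_pos m with rfl | hm
      · simp [hδ.ne']
      have hm' : (0 : ℝ) < m := by exact_mod_cast hm
      calc ∑ t ∈ Finset.range m, ((t + 1 : ℕ) : ℝ) ^ (δ - 1)
          ≤ ∑ _t ∈ Finset.range m, (m : ℝ) ^ (δ - 1) := by
            refine Finset.sum_le_sum fun t ht => ?_
            refine Real.rpow_le_rpow (by positivity) ?_ (by linarith)
            exact_mod_cast Finset.mem_range.1 ht
        _ = (m : ℝ) ^ δ := by
            rw [Finset.sum_const, Finset.card_range, nsmul_eq_mul, Real.rpow_sub_one hm'.ne']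
            field_simp
    exact h2.trans (le_mul_of_one_le_left (by positivity) (le_max_left _ _))
  · have h2 : ∑ t ∈ Finset.range m, ((t + 1 : ℕ) : ℝ) ^ (δ - 1) ≤ δ⁻¹ * (m : ℝ) ^ δ := by
      induction m with
      | zero => simp [hδ.ne']
      | succ m ih =>
        rw [Finset.sum_range_succ]
        have hpos : (0 : ℝ) < ((m + 1 : ℕ) : ℝ) := by positivity
        -- concavity of `x ↦ x ^ δ`
        have h3 := rpow_one_add_le_one_add_mul_self (s := -(((m + 1 : ℕ) : ℝ))⁻¹) (p := δ)
          (by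
            have : (((m + 1 : ℕ) : ℝ))⁻¹ ≤ 1 := inv_le_one_of_one_le₀ (by push_cast; linarith)
            linarith) hδ.le h1
        have e : 1 + -(((m + 1 : ℕ) : ℝ))⁻¹ = m / ((m + 1 : ℕ) : ℝ) := by
          push_cast; field_simp; ring
        rw [e, Real.div_rpow (by positivity) hpos.le, div_le_iff₀ (by positivity)] at h3
        have h4 : (m : ℝ) ^ δ ≤ ((m + 1 : ℕ) : ℝ) ^ δ - δ * ((m + 1 : ℕ) : ℝ) ^ (δ - 1) := by
          rw [Real.rpow_sub_one hpos.ne']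
          refine h3.trans (le_of_eq ?_)
          field_simp
          ring
        calc _ ≤ δ⁻¹ * (m : ℝ) ^ δ + ((m + 1 : ℕ) : ℝ) ^ (δ - 1) := by gcongr
          _ ≤ δ⁻¹ * (((m + 1 : ℕ) : ℝ) ^ δ - δ * ((m + 1 : ℕ) : ℝ) ^ (δ - 1))
              + ((m + 1 : ℕ) : ℝ) ^ (δ - 1) := by gcongr
          _ = _ := by field_simp; ring
    exact h2.trans (mul_le_mul_of_nonneg_right (le_max_right _ _) (by positivity))

/-- The distance of a cell of the block `[-1/2, 1/2]ᵈ` to `0`, up to constants; it is at least the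
mesh width. -/
noncomputable def cellDist {m : ℕ} (q : Fin d → Fin m) : ℝ := level q / m

theorem cellDist_pos {m : ℕ} (hm : 0 < m) (q : Fin d → Fin m) : 0 < cellDist q := by
  have h1 : (0 : ℝ) < level q := by exact_mod_cast one_le_level q
  have h2 : (0 : ℝ) < m := by exact_mod_cast hm
  exact div_pos h1 h2

theorem exists_sum_cellDist_rpow_le (hd : 0 < d) {γ : ℝ} (hγ : -(d : ℝ) < γ) :
    ∃ C : ℝ, 0 ≤ C ∧ ∀ m : ℕ, 0 < m →
      ((m : ℝ) ^ d)⁻¹ * ∑ q : Fin d → Fin m, cellDist q ^ γ ≤ C := by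
  refine ⟨(2 * d : ℕ) * max 1 (d + γ)⁻¹, by positivity, fun m hm => ?_⟩
  have hm' : (0 : ℝ) < m := by exact_mod_cast hm
  have h1 := sum_level_le hd m (F := fun t => ((t : ℝ) / m) ^ γ) fun t => by positivity
  have h2 := sum_rpow_sub_one_le (δ := d + γ) (by linarith) m
  have h3 : ∑ t ∈ Finset.range m, ((t + 1 : ℕ) : ℝ) ^ (d - 1) * (((t + 1 : ℕ) : ℝ) / m) ^ γ
      = ((m : ℝ) ^ γ)⁻¹ * ∑ t ∈ Finset.range m, ((t + 1 : ℕ) : ℝ) ^ (d + γ - 1) := by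
    rw [Finset.mul_sum]
    refine Finset.sum_congr rfl fun t _ => ?_
    have ht : (0 : ℝ) < ((t + 1 : ℕ) : ℝ) := by positivity
    rw [Real.div_rpow ht.le hm'.le, ← Real.rpow_natCast _ (d - 1), Nat.cast_sub hd,
      show (d : ℝ) + γ - 1 = (d - 1) + γ by ring, Real.rpow_add ht, Nat.cast_one]
    field_simp
  rw [h3] at h1
  calc ((m : ℝ) ^ d)⁻¹ * ∑ q : Fin d → Fin m, cellDist q ^ γ
      ≤ ((m : ℝ) ^ d)⁻¹ * ((2 * d : ℕ) * (((m : ℝ) ^ γ)⁻¹ *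
          (max 1 (d + γ)⁻¹ * (m : ℝ) ^ (d + γ)))) := by
        refine mul_le_mul_of_nonneg_left (h1.trans ?_) (by positivity)
        gcongr
    _ = _ := by
        rw [Real.rpow_add hm', Real.rpow_natCast]
        field_simp

theorem exists_sum_cellDist_neg_rpow_le (hd : 0 < d) :
    ∃ C : ℝ, 0 ≤ C ∧ ∀ m : ℕ, 2 ≤ m →
      ((m : ℝ) ^ d)⁻¹ * ∑ q : Fin d → Fin m, cellDist q ^ (-(d : ℝ)) ≤ C * Real.log m := by
  have hl2 : 0 < Real.log 2 := Real.log_pos (by norm_num)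
  refine ⟨(2 * d : ℕ) * ((Real.log 2)⁻¹ + 1), by positivity, fun m hm => ?_⟩
  have hm' : (0 : ℝ) < m := by exact_mod_cast (by omega : 0 < m)
  have h1 := sum_level_le hd m (F := fun t => ((t : ℝ) / m) ^ (-(d : ℝ))) fun t => by positivity
  have h3 : ∑ t ∈ Finset.range m,
        ((t + 1 : ℕ) : ℝ) ^ (d - 1) * (((t + 1 : ℕ) : ℝ) / m) ^ (-(d : ℝ))
      = (m : ℝ) ^ d * (harmonic m : ℝ) := by
    rw [harmonic]
    push_cast
    rw [Finset.mul_sum]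
    refine Finset.sum_congr rfl fun t _ => ?_
    have ht : (0 : ℝ) < (t : ℝ) + 1 := by positivity
    obtain ⟨e, rfl⟩ : ∃ e, d = e + 1 := ⟨d - 1, by omega⟩
    rw [Real.rpow_neg (by positivity), Real.rpow_natCast, div_pow, Nat.add_sub_cancel,
      pow_succ ((t : ℝ) + 1)]
    field_simp
  have hlog : Real.log 2 ≤ Real.log m := Real.log_le_log (by norm_num) (by exact_mod_cast hm)
  have h4 : (harmonic m : ℝ) ≤ ((Real.log 2)⁻¹ + 1) * Real.log m := by
    refine (harmonic_le_one_add_log m).trans ?_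
    rw [add_mul, one_mul]
    gcongr
    rw [inv_mul_eq_div, le_div_iff₀ hl2]
    linarith
  rw [h3] at h1
  calc ((m : ℝ) ^ d)⁻¹ * ∑ q : Fin d → Fin m, cellDist q ^ (-(d : ℝ))
      ≤ ((m : ℝ) ^ d)⁻¹ * ((2 * d : ℕ) *
          ((m : ℝ) ^ d * (((Real.log 2)⁻¹ + 1) * Real.log m))) := by
        refine mul_le_mul_of_nonneg_left (h1.trans ?_) (by positivity)
        gcongr
    _ = _ := by field_simp

/-- The sum that produces the logarithm: it occurs when `d + γ = r`. -/
theorem exists_sum_cellDist_rpow_mul_le (hd : 0 < d) {γ r : ℝ} (hr : r ≤ d + γ) :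
    ∃ C : ℝ, 0 ≤ C ∧ ∀ m : ℕ, 2 ≤ m →
      ((m : ℝ) ^ d)⁻¹ * ∑ q : Fin d → Fin m, cellDist q ^ γ * ((level q : ℝ) ^ r)⁻¹
        ≤ C * (Real.log m / (m : ℝ) ^ r) := by
  obtain ⟨C, hC, h⟩ := exists_sum_cellDist_neg_rpow_le hd
  refine ⟨C, hC, fun m hm => ?_⟩
  have hm0 : 0 < m := by omega
  have hm' : (0 : ℝ) < m := by exact_mod_cast hm0
  have h1 : ∀ q : Fin d → Fin m, cellDist q ^ γ * ((level q : ℝ) ^ r)⁻¹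
      ≤ ((m : ℝ) ^ r)⁻¹ * cellDist q ^ (-(d : ℝ)) := by
    intro q
    have hl : (0 : ℝ) < level q := by exact_mod_cast one_le_level q
    have hρ := cellDist_pos hm0 q
    have hρ1 : cellDist q ≤ 1 := (div_le_one hm').2 (by exact_mod_cast level_le hd q)
    have e : (level q : ℝ) = m * cellDist q := by rw [cellDist]; field_simp
    have h2 : cellDist q ^ (γ - r) ≤ cellDist q ^ (-(d : ℝ)) :=
      Real.rpow_le_rpow_of_exponent_ge hρ hρ1 (by linarith)
    calc cellDist q ^ γ * ((level q : ℝ) ^ r)⁻¹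
        = ((m : ℝ) ^ r)⁻¹ * cellDist q ^ (γ - r) := by
          rw [e, Real.mul_rpow hm'.le hρ.le, Real.rpow_sub hρ]
          field_simp
      _ ≤ _ := by gcongr
  calc _ ≤ ((m : ℝ) ^ d)⁻¹ * ∑ q : Fin d → Fin m, ((m : ℝ) ^ r)⁻¹ * cellDist q ^ (-(d : ℝ)) := by
        exact mul_le_mul_of_nonneg_left (Finset.sum_le_sum fun q _ => h1 q) (by positivity)
    _ = ((m : ℝ) ^ r)⁻¹ * (((m : ℝ) ^ d)⁻¹ * ∑ q : Fin d → Fin m, cellDist q ^ (-(d : ℝ))) := by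
        rw [← Finset.mul_sum]; ring
    _ ≤ ((m : ℝ) ^ r)⁻¹ * (C * Real.log m) := by
        exact mul_le_mul_of_nonneg_left (h m hm) (by positivity)
    _ = _ := by rw [div_eq_mul_inv]; ring

end Counting

/-! ### Cells and nodes -/

section Cells

variable {n d : ℕ}

/-- The lower corner of a cell of the block `[-1/2, 1/2]ᵈ`. -/
noncomputable def blockCorner {m : ℕ} (q : Fin d → Fin m) : Fin d → ℝ :=
  fun k => -(1 / 2) + ((q k : ℕ) : ℝ) / m

theorem abs_coord_sub_offCenter_le {m : ℕ} (hm : 0 < m) (t : Fin m) {τ : ℝ}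
    (h : τ ∈ Set.Icc (-(1 / 2) + ((t : ℕ) : ℝ) / m) (-(1 / 2) + ((t : ℕ) : ℝ) / m + 1 / m)) :
    |2 * m * |τ| - offCenter t| ≤ 1 := by
  have hm' : (0 : ℝ) < m := by exact_mod_cast hm
  have e : ((offCenter t : ℕ) : ℝ) = |2 * ((t : ℕ) : ℝ) + 1 - m| := by
    rw [offCenter, Nat.cast_natAbs]
    push_cast
    rfl
  have e2 : 2 * m * |τ| = |2 * m * τ| := by
    rw [abs_mul, abs_of_pos (by positivity : (0 : ℝ) < 2 * m)]
  rw [e, e2]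
  refine (abs_abs_sub_abs_le_abs_sub _ _).trans ?_
  have h1 := mul_le_mul_of_nonneg_left h.1 (by positivity : (0 : ℝ) ≤ 2 * m)
  have h2 := mul_le_mul_of_nonneg_left h.2 (by positivity : (0 : ℝ) ≤ 2 * m)
  have e3 : 2 * (m : ℝ) * (-(1 / 2) + ((t : ℕ) : ℝ) / m) = -m + 2 * ((t : ℕ) : ℝ) := by
    field_simp
  have e4 : 2 * (m : ℝ) * (-(1 / 2) + ((t : ℕ) : ℝ) / m + 1 / m)
      = -m + 2 * ((t : ℕ) : ℝ) + 2 := by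
    field_simp
  rw [e3] at h1
  rw [e4] at h2
  rw [abs_le]
  constructor <;> linarith

theorem norm_le_cellDist {m : ℕ} (hm : 0 < m) (q : Fin d → Fin m) {y : EuclideanSpace ℝ (Fin d)}
    (hy : y ∈ blockBox (blockCorner q) (1 / m)) : ‖y‖ ≤ d * cellDist q := by
  have hm' : (0 : ℝ) < m := by exact_mod_cast hm
  refine norm_le_of_abs_coord_le fun k => ?_
  have h1 := (abs_le.1 (abs_coord_sub_offCenter_le hm (q k) (hy k))).2
  have h2 : ((offCenter (q k) : ℕ) : ℝ) + 1 ≤ level q := by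
    exact_mod_cast offCenter_lt_level q k
  rw [cellDist, le_div_iff₀ hm']
  nlinarith [mul_nonneg (abs_nonneg (y k)) hm'.le]

theorem cellDist_le_norm (hd : 0 < d) {m : ℕ} (hm : 0 < m) (q : Fin d → Fin m)
    (hq : 3 ≤ level q) {y : EuclideanSpace ℝ (Fin d)}
    (hy : y ∈ blockBox (blockCorner q) (1 / m)) : cellDist q / 6 ≤ ‖y‖ := by
  have hm' : (0 : ℝ) < m := by exact_mod_cast hm
  obtain ⟨k, hk⟩ := exists_offCenter_eq hd q
  refine le_trans ?_ (abs_coord_le_norm y k)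
  have h1 := (abs_le.1 (abs_coord_sub_offCenter_le hm (q k) (hy k))).1
  have h2 : ((offCenter (q k) : ℕ) : ℝ) + 1 = level q := by exact_mod_cast hk
  have h3 : (3 : ℝ) ≤ level q := by exact_mod_cast hq
  rw [cellDist, div_div, div_le_iff₀ (by positivity)]
  linarith

theorem rpow_le_of_le_of_le {c D ρ t : ℝ} (e : ℝ) (hc : 0 < c) (hρ : 0 < ρ) (h1 : c * ρ ≤ t)
    (h2 : t ≤ D * ρ) : t ^ e ≤ (c ^ e + D ^ e) * ρ ^ e := by
  have ht : 0 < t := lt_of_lt_of_le (by positivity) h1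
  have hD : 0 < D := by
    by_contra h
    nlinarith
  rw [add_mul, ← Real.mul_rpow hc.le hρ.le, ← Real.mul_rpow hD.le hρ.le]
  have p1 : 0 ≤ (c * ρ) ^ e := by positivity
  have p2 : 0 ≤ (D * ρ) ^ e := by positivity
  rcases le_total 0 e with he | he
  · linarith [Real.rpow_le_rpow ht.le h2 he]
  · linarith [Real.rpow_le_rpow_of_nonpos (by positivity) h1 he]

theorem measureReal_blockBox (c : Fin d → ℝ) {h : ℝ} (hh : 0 < h) :
    volume.real (blockBox c h) = h ^ d := by
  have := setIntegral_blockBox_prod c h fun _ _ => 1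
  simpa [hh.le] using this

theorem exists_integral_ball_norm_rpow (hd : 0 < d) {e : ℝ} (he : -(d : ℝ) < e) :
    ∃ C : ℝ, 0 ≤ C ∧ ∀ r : ℝ, 0 < r →
      IntegrableOn (fun y : EuclideanSpace ℝ (Fin d) => ‖y‖ ^ e) (Metric.ball 0 r) ∧
      ∫ y in Metric.ball (0 : EuclideanSpace ℝ (Fin d)) r, ‖y‖ ^ e = C * r ^ (d + e) := by
  have : Nontrivial (EuclideanSpace ℝ (Fin d)) := by
    have : Nonempty (Fin d) := ⟨⟨0, hd⟩⟩
    infer_instance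
  have hdim : Module.finrank ℝ (EuclideanSpace ℝ (Fin d)) = d := by simp
  have hpow : ∀ y : ℝ, 0 < y → y ^ (d - 1) * y ^ e = y ^ (d + e - 1) := fun y hy => by
    rw [← Real.rpow_natCast, ← Real.rpow_add hy, Nat.cast_sub hd, Nat.cast_one]
    congr 1; ring
  refine ⟨d * (volume.real (Metric.ball (0 : EuclideanSpace ℝ (Fin d)) 1) * (d + e)⁻¹),
    ?_, fun r hr => ⟨?_, ?_⟩⟩
  · have : 0 < d + e := by linarith
    positivity
  · rw [integrableOn_fun_norm_addHaar volume (f := fun t : ℝ => t ^ e), hdim]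
    refine ((intervalIntegral.integrableOn_Ioo_rpow_iff hr).2
      (by linarith : -1 < (d : ℝ) + e - 1)).congr_fun (fun y hy => ?_) measurableSet_Ioo
    rw [smul_eq_mul, hpow y hy.1]
  · have h1 : ∫ y in Metric.ball (0 : EuclideanSpace ℝ (Fin d)) r, ‖y‖ ^ e
        = ∫ y : EuclideanSpace ℝ (Fin d), (Set.Iio r).indicator (fun t : ℝ => t ^ e) ‖y‖ := by
      rw [← integral_indicator measurableSet_ball]
      refine integral_congr_ae (Eventually.of_forall fun y => ?_)
      simp [Set.indicator]
    rw [h1, integral_fun_norm_addHaar volume ((Set.Iio r).indicator fun t : ℝ => t ^ e), hdim]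
    have h2 : ∫ y in Set.Ioi (0 : ℝ), y ^ (d - 1) • (Set.Iio r).indicator (fun t : ℝ => t ^ e) y
        = ∫ y in Set.Ioo 0 r, y ^ ((d : ℝ) + e - 1) := by
      rw [← integral_indicator measurableSet_Ioi, ← integral_indicator measurableSet_Ioo]
      refine integral_congr_ae (Eventually.of_forall fun y => ?_)
      by_cases hy0 : 0 < y
      · by_cases hyr : y < r
        · simp [Set.indicator, hy0, hyr, hpow y hy0]
        · simp [Set.indicator, hyr]
      · simp [Set.indicator, hy0]
    rw [h2, ← integral_Ioc_eq_integral_Ioo, ← intervalIntegral.integral_of_le hr.le,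
      integral_rpow (Or.inl (by linarith)), sub_add_cancel, Real.zero_rpow (by linarith)]
    simp only [nsmul_eq_mul, smul_eq_mul]
    ring

/-- The integral of `|y|^e` over a cell of a block is at most a constant times the volume of the
cell times `cellDist ^ e`, also for the cells at the singularity, because `e > -d`. -/
theorem exists_integral_cell_le (hd : 0 < d) {e : ℝ} (he : -(d : ℝ) < e) :
    ∃ C : ℝ, 0 ≤ C ∧ ∀ m : ℕ, 0 < m → ∀ q : Fin d → Fin m,
      IntegrableOn (fun y : EuclideanSpace ℝ (Fin d) => ‖y‖ ^ e)
        (blockBox (blockCorner q) (1 / m)) ∧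
      ∫ y in blockBox (blockCorner q) (1 / m), ‖y‖ ^ e
        ≤ C * (((m : ℝ) ^ d)⁻¹ * cellDist q ^ e) := by
  obtain ⟨C, hC, hball⟩ := exists_integral_ball_norm_rpow hd he
  set C₁ : ℝ := (1 / 6) ^ e + (d : ℝ) ^ e
  set C₂ : ℝ := C * ((2 * d) ^ (d + e) * 2 ^ d) with hC₂
  have hC₁0 : 0 ≤ C₁ := by positivity
  have hC₂0 : 0 ≤ C₂ := by positivity
  refine ⟨C₁ + C₂, by positivity, fun m hm q => ?_⟩
  have hd' : (0 : ℝ) < d := by exact_mod_cast hd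
  have hm' : (0 : ℝ) < m := by exact_mod_cast hm
  have hρ := cellDist_pos hm q
  have hsub : blockBox (blockCorner q) (1 / m) ⊆ Metric.ball 0 (2 * d * cellDist q) := by
    intro y hy
    rw [mem_ball_zero_iff]
    have h1 := norm_le_cellDist hm q hy
    have h2 : 0 < d * cellDist q := by positivity
    linarith
  obtain ⟨hi, hint⟩ := hball (2 * d * cellDist q) (by positivity)
  have hp : 0 ≤ ((m : ℝ) ^ d)⁻¹ * cellDist q ^ e := by positivity
  refine ⟨hi.mono_set hsub, ?_⟩
  -- cells of level at most `2` may contain `0`; they lie in a ball of radius about `1 / m`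
  rcases Nat.lt_or_ge (level q) 3 with hq | hq
  · have h1 : ∫ y in blockBox (blockCorner q) (1 / m), ‖y‖ ^ e
        ≤ C * (2 * d * cellDist q) ^ (d + e) := by
      rw [← hint]
      exact setIntegral_mono_set hi (Eventually.of_forall fun y => by positivity)
        hsub.eventuallyLE
    have h2 : cellDist q ^ d ≤ 2 ^ d * ((m : ℝ) ^ d)⁻¹ := by
      rw [← inv_pow, ← mul_pow]
      refine pow_le_pow_left₀ hρ.le ?_ d
      rw [cellDist, div_eq_mul_inv]
      have : (level q : ℝ) ≤ 2 := by exact_mod_cast (by omega : level q ≤ 2)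
      gcongr
    calc _ ≤ C * (2 * d * cellDist q) ^ (d + e) := h1
      _ = C * ((2 * d) ^ (d + e) * (cellDist q ^ d * cellDist q ^ e)) := by
        rw [Real.mul_rpow (by positivity) hρ.le, Real.rpow_add hρ, Real.rpow_natCast]
      _ ≤ C * ((2 * d) ^ (d + e) * (2 ^ d * ((m : ℝ) ^ d)⁻¹ * cellDist q ^ e)) := by gcongr
      _ = C₂ * (((m : ℝ) ^ d)⁻¹ * cellDist q ^ e) := by rw [hC₂]; ring
      _ ≤ _ := mul_le_mul_of_nonneg_right (by linarith) hp
  · have h1 : ∫ y in blockBox (blockCorner q) (1 / m), ‖y‖ ^ e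
        ≤ ∫ _y in blockBox (blockCorner q) (1 / m), C₁ * cellDist q ^ e := by
      refine setIntegral_mono_on (hi.mono_set hsub)
        (continuousOn_const.integrableOn_compact (isCompact_blockBox _ _))
        (isCompact_blockBox _ _).measurableSet fun y hy => ?_
      refine rpow_le_of_le_of_le e (by norm_num) hρ ?_ (norm_le_cellDist hm q hy)
      have := cellDist_le_norm hd hm q hq hy
      linarith
    rw [setIntegral_const, measureReal_blockBox _ (by positivity)] at h1
    calc _ ≤ _ := h1
      _ = C₁ * (((m : ℝ) ^ d)⁻¹ * cellDist q ^ e) := by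
        rw [smul_eq_mul, one_div, inv_pow]; ring
      _ ≤ _ := mul_le_mul_of_nonneg_right (by linarith) hp

/-- The lower corner of a cell of the cube. -/
noncomputable def cellCorner {m : ℕ} (j : Fin n × Fin d → Fin m) : Fin n × Fin d → ℝ :=
  fun l => -(1 / 2) + ((j l : ℕ) : ℝ) / m

/-- The cell of the cube with index `j`. -/
noncomputable def cell {m : ℕ} (j : Fin n × Fin d → Fin m) : Set (Pt n d) :=
  box (cellCorner j) (1 / m)

theorem mem_blockBox_of_mem_cell {m : ℕ} {j : Fin n × Fin d → Fin m} {x : Pt n d}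
    (hx : x ∈ cell j) (i : Fin n) :
    x i ∈ blockBox (blockCorner fun k => j (i, k)) (1 / m) := fun k => hx i k

theorem cell_subset_cube {m : ℕ} (hm : 0 < m) (j : Fin n × Fin d → Fin m) :
    cell j ⊆ cube n d := by
  intro x hx i k
  have hm' : (0 : ℝ) < m := by exact_mod_cast hm
  have h := hx i k
  have h1 : (((j (i, k) : ℕ) : ℝ) + 1) / m ≤ 1 := by
    rw [div_le_one hm']
    exact_mod_cast (j (i, k)).2
  have h2 : (0 : ℝ) ≤ ((j (i, k) : ℕ) : ℝ) / m := by positivity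
  simp only [cellCorner, Set.mem_Icc] at h
  rw [add_div] at h1
  constructor <;> linarith [h.1, h.2]

theorem node_mem_cell {xs : Fin n × Fin d → ℝ} (hxs : ∀ l, xs l ∈ Set.Icc (0 : ℝ) 1) {m : ℕ}
    (hm : 0 < m) (j : Fin n × Fin d → Fin m) : node xs m j ∈ cell j := by
  intro i k
  have hm' : (0 : ℝ) < m := by exact_mod_cast hm
  have h1 : 0 ≤ xs (i, k) / m := div_nonneg (hxs _).1 hm'.le
  have h2 : xs (i, k) / m ≤ 1 / m := div_le_div_of_nonneg_right (hxs _).2 hm'.le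
  simp only [node, cellCorner, Set.mem_Icc, add_div]
  constructor <;> linarith

theorem relCoord_node (xs : Fin n × Fin d → ℝ) {m : ℕ} (hm : 0 < m)
    (j : Fin n × Fin d → Fin m) : relCoord (cellCorner j) (1 / m) (node xs m j) = xs := by
  funext l
  have hm' : (m : ℝ) ≠ 0 := by exact_mod_cast hm.ne'
  simp only [relCoord, node, cellCorner]
  field_simp
  ring

theorem exists_le_abs_intCast_add (y : ℝ) :
    ∃ c : ℝ, 0 < c ∧ ∀ z : ℤ, (z : ℝ) + y ≠ 0 → c ≤ |(z : ℝ) + y| := by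
  by_cases h : Int.fract y = 0
  · refine ⟨1, one_pos, fun z hz => ?_⟩
    have e : (z : ℝ) + y = ((z + ⌊y⌋ : ℤ) : ℝ) := by
      push_cast
      linarith [Int.floor_add_fract y]
    rw [e] at hz ⊢
    have h1 : z + ⌊y⌋ ≠ 0 := by exact_mod_cast hz
    exact_mod_cast Int.one_le_abs h1
  · have h0 : 0 < Int.fract y := lt_of_le_of_ne (Int.fract_nonneg y) (Ne.symm h)
    have h1 := Int.fract_lt_one y
    refine ⟨min (Int.fract y) (1 - Int.fract y), lt_min h0 (by linarith), fun z _ => ?_⟩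
    have e : (z : ℝ) + y = ((z + ⌊y⌋ : ℤ) : ℝ) + Int.fract y := by
      push_cast
      linarith [Int.floor_add_fract y]
    rw [e]
    rcases le_or_gt 0 (z + ⌊y⌋) with h2 | h2
    · have h3 : (0 : ℝ) ≤ ((z + ⌊y⌋ : ℤ) : ℝ) := by exact_mod_cast h2
      exact (min_le_left _ _).trans (le_trans (by linarith) (le_abs_self _))
    · have h3 : ((z + ⌊y⌋ : ℤ) : ℝ) ≤ -1 := by exact_mod_cast (by omega : z + ⌊y⌋ ≤ -1)
      exact (min_le_right _ _).trans (le_trans (by linarith) (neg_le_abs _))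

/-- For a fixed offset, the nonzero nodes keep a distance to `0` proportional to the mesh
width. -/
theorem exists_le_norm_node (xs : Fin n × Fin d → ℝ) :
    ∃ c : ℝ, 0 < c ∧ ∀ m : ℕ, 0 < m → ∀ (j : Fin n × Fin d → Fin m) (i : Fin n),
      node xs m j i ≠ 0 → c / m ≤ ‖node xs m j i‖ := by
  choose c hc0 hc using fun l : Fin n × Fin d => exists_le_abs_intCast_add (2 * xs l)
  obtain ⟨c', hc', hle⟩ : ∃ c' : ℝ, 0 < c' ∧ ∀ l, c' ≤ c l := by
    rcases isEmpty_or_nonempty (Fin n × Fin d) with h | h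
    · exact ⟨1, one_pos, fun l => h.elim l⟩
    · obtain ⟨l₀, h0⟩ := Finite.exists_min c
      exact ⟨c l₀, hc0 l₀, h0⟩
  refine ⟨c' / 2, by positivity, fun m hm j i hne => ?_⟩
  have hm' : (0 : ℝ) < m := by exact_mod_cast hm
  obtain ⟨k, hk⟩ : ∃ k, node xs m j i k ≠ 0 := by
    by_contra! h
    exact hne (by ext k; simpa using h k)
  have e : node xs m j i k
      = (((2 * ((j (i, k) : ℕ) : ℤ) - m : ℤ) : ℝ) + 2 * xs (i, k)) / (2 * m) := by
    simp only [node]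
    push_cast
    field_simp
    ring
  refine le_trans ?_ (abs_coord_le_norm _ k)
  rw [e] at hk ⊢
  have h1 := (hle (i, k)).trans (hc (i, k) _ (div_ne_zero_iff.1 hk).1)
  rw [abs_div, abs_of_pos (by positivity : (0 : ℝ) < 2 * m), div_div]
  gcongr

end Cells

/-! ### Decomposition of the cube -/

section Decomposition

variable {𝕜 : Type*} [RCLike 𝕜] {n d : ℕ}

theorem quasiMeasurePreserving_coord (l : Fin n × Fin d) :
    Measure.QuasiMeasurePreserving (fun x : Pt n d => x l.1 l.2) := by
  have h1 : Measure.QuasiMeasurePreserving (fun x : Pt n d => x l.1) :=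
    Measure.quasiMeasurePreserving_eval (fun _ => volume) l.1
  have h2 : Measure.QuasiMeasurePreserving (fun y : Fin d → ℝ => y l.2) :=
    Measure.quasiMeasurePreserving_eval (fun _ => volume) l.2
  exact (h2.comp (PiLp.volume_preserving_ofLp (Fin d)).quasiMeasurePreserving).comp h1

theorem measure_coord_eq (l : Fin n × Fin d) (c : ℝ) :
    volume {x : Pt n d | x l.1 l.2 = c} = 0 :=
  (quasiMeasurePreserving_coord l).preimage_null (s := {c}) (by simp)

theorem ae_mem_regularSet (hd : 0 < d) : ∀ᵐ x : Pt n d, x ∈ regularSet n d := by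
  refine ae_all_iff.2 fun i => ?_
  have h := measure_coord_eq (i, (⟨0, hd⟩ : Fin d)) 0
  refine measure_mono_null (fun x hx => ?_) h
  have hx0 : x i = 0 := by simpa using hx
  change x i ⟨0, hd⟩ = 0
  rw [hx0]
  rfl

theorem iUnion_cell {m : ℕ} (hm : 0 < m) :
    (⋃ j : Fin n × Fin d → Fin m, cell j) = cube n d := by
  refine Set.Subset.antisymm (Set.iUnion_subset fun j => cell_subset_cube hm j) fun x hx => ?_
  have hm' : (0 : ℝ) < m := by exact_mod_cast hm
  have key : ∀ l : Fin n × Fin d, ∃ t : Fin m, x l.1 l.2 ∈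
      Set.Icc (-(1 / 2) + ((t : ℕ) : ℝ) / m) (-(1 / 2) + ((t : ℕ) : ℝ) / m + 1 / m) := by
    intro l
    have h := hx l.1 l.2
    simp only [Set.mem_Icc] at h
    set y : ℝ := m * (x l.1 l.2 + 1 / 2) with hy
    have hy0 : 0 ≤ y := mul_nonneg hm'.le (by linarith [h.1])
    have hym : y ≤ m := by
      have := mul_le_mul_of_nonneg_left (by linarith [h.2] : x l.1 l.2 + 1 / 2 ≤ 1) hm'.le
      linarith
    have e : x l.1 l.2 = -(1 / 2) + y / m := by rw [hy]; field_simp; ring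
    obtain ⟨t, ht1, ht2⟩ : ∃ t : Fin m, ((t : ℕ) : ℝ) ≤ y ∧ y ≤ ((t : ℕ) : ℝ) + 1 := by
      rcases lt_or_eq_of_le hym with h1 | h1
      · exact ⟨⟨⌊y⌋₊, (Nat.floor_lt hy0).2 h1⟩, Nat.floor_le hy0, (Nat.lt_floor_add_one y).le⟩
      · refine ⟨⟨m - 1, by omega⟩, ?_, ?_⟩ <;>
          simp only [Nat.cast_sub (Nat.one_le_of_lt hm), Nat.cast_one] <;> linarith
    refine ⟨t, ?_⟩
    rw [e, add_assoc, ← add_div]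
    constructor <;> gcongr
  choose t ht using key
  exact Set.mem_iUnion.2 ⟨t, fun i k => ht (i, k)⟩

theorem aedisjoint_cell {m : ℕ} (hm : 0 < m) :
    Pairwise (Function.onFun (AEDisjoint volume)
      (fun j : Fin n × Fin d → Fin m => (cell j : Set (Pt n d)))) := by
  have hm' : (0 : ℝ) < m := by exact_mod_cast hm
  have main : ∀ (j j' : Fin n × Fin d → Fin m) (l : Fin n × Fin d), j l < j' l →
      volume (cell j ∩ cell j' : Set (Pt n d)) = 0 := by
    intro j j' l hl
    refine measure_mono_null (fun x hx => ?_)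
      (measure_coord_eq l (-(1 / 2) + ((j' l : ℕ) : ℝ) / m))
    have h1 := (hx.1 l.1 l.2).2
    have h2 := (hx.2 l.1 l.2).1
    simp only [cellCorner] at h1 h2
    have h3 : (((j l : ℕ) : ℝ) + 1) / m ≤ ((j' l : ℕ) : ℝ) / m := by
      gcongr
      exact_mod_cast hl
    rw [add_div] at h3
    exact le_antisymm (by linarith) h2
  intro j j' hne
  obtain ⟨l, hl⟩ := Function.ne_iff.1 hne
  rcases lt_or_gt_of_ne hl with h | h
  · exact main j j' l h
  · have := main j' j l h
    rwa [Set.inter_comm] at this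

theorem setIntegral_cube_eq_sum {m : ℕ} (hm : 0 < m) {F : Pt n d → 𝕜}
    (hF : IntegrableOn F (cube n d)) :
    ∫ x in cube n d, F x = ∑ j : Fin n × Fin d → Fin m, ∫ x in cell j, F x := by
  rw [← iUnion_cell hm] at hF ⊢
  have hmeas : ∀ j : Fin n × Fin d → Fin m,
      NullMeasurableSet (cell j : Set (Pt n d)) := fun j =>
    (isCompact_box _ _).measurableSet.nullMeasurableSet
  rw [integral_iUnion_ae hmeas (aedisjoint_cell hm) hF, tsum_fintype]

end Decomposition

/-! ### Majorants and their integrals over cells -/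

section Majorants

variable {n d : ℕ}

/-- The sum over `i` of `∏ₖ |xₖ|^(γₖ)` with the `i`-th exponent lowered by `s`: up to constants,
this bounds the derivatives of order `s` of the fractional form. -/
noncomputable def majorant (γ : Fin n → ℝ) (s : ℕ) (x : Pt n d) : ℝ :=
  ∑ i, ∏ k, ‖x k‖ ^ (γ k - if k = i then (s : ℝ) else 0)

theorem prod_rpow_sub_ite (γ : Fin n → ℝ) (s : ℝ) (i : Fin n) {ρ : Fin n → ℝ}
    (hρ : ∀ k, 0 < ρ k) :
    ∏ k, ρ k ^ (γ k - if k = i then s else 0) = (∏ k, ρ k ^ γ k) * (ρ i ^ s)⁻¹ := by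
  have h : ∀ k, ρ k ^ (γ k - if k = i then s else 0)
      = ρ k ^ γ k * if k = i then (ρ i ^ s)⁻¹ else 1 := by
    intro k
    split_ifs with hk
    · subst hk
      rw [Real.rpow_sub (hρ k), div_eq_mul_inv]
    · rw [sub_zero, mul_one]
  rw [Finset.prod_congr rfl fun k _ => h k, Finset.prod_mul_distrib]
  simp

theorem sum_pow_le {ι : Type*} [Fintype ι] {b : ι → ℝ} (hb : ∀ i, 0 ≤ b i) (hι : Nonempty ι)
    (s : ℕ) : (∑ i, b i) ^ s ≤ (Fintype.card ι : ℝ) ^ s * ∑ i, b i ^ s := by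
  obtain ⟨i₀, h0⟩ := Finite.exists_max b
  calc (∑ i, b i) ^ s ≤ ((Fintype.card ι : ℝ) * b i₀) ^ s := by
        refine pow_le_pow_left₀ (Finset.sum_nonneg fun i _ => hb i) ?_ s
        refine (Finset.sum_le_sum fun i _ => h0 i).trans (le_of_eq ?_)
        simp
    _ = (Fintype.card ι : ℝ) ^ s * b i₀ ^ s := mul_pow _ _ _
    _ ≤ _ := by
        refine mul_le_mul_of_nonneg_left ?_ (by positivity)
        exact Finset.single_le_sum (f := fun i => b i ^ s) (fun i _ => pow_nonneg (hb i) s)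
          (Finset.mem_univ i₀)

theorem prod_mul_invSum_pow_le (hn : 0 < n) (γ : Fin n → ℝ) (s : ℕ) {x : Pt n d}
    (hx : x ∈ regularSet n d) :
    (∏ i, ‖x i‖ ^ γ i) * invSum x ^ s ≤ (n : ℝ) ^ s * majorant γ s x := by
  have hpos : ∀ k, 0 < ‖x k‖ := fun k => norm_pos_iff.2 (hx k)
  have h1 := sum_pow_le (b := fun i => ‖x i‖⁻¹) (fun i => inv_nonneg.2 (norm_nonneg _))
    ⟨⟨0, hn⟩⟩ s
  rw [Fintype.card_fin] at h1
  refine (mul_le_mul_of_nonneg_left h1 (Finset.prod_nonneg fun i _ => by positivity)).trans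
    (le_of_eq ?_)
  rw [majorant, mul_left_comm, Finset.mul_sum]
  congr 1
  refine Finset.sum_congr rfl fun i _ => ?_
  rw [prod_rpow_sub_ite γ s i hpos, Real.rpow_natCast, inv_pow]

/-- The product `∏ᵢ ρᵢ^(γᵢ)`, where `ρᵢ = cellDist` is the distance of the `i`-th block of the cell
to `0`. -/
noncomputable def cellWeight (γ : Fin n → ℝ) {m : ℕ} (j : Fin n × Fin d → Fin m) : ℝ :=
  ∏ i, cellDist (fun k => j (i, k)) ^ γ i

/-- The sum `∑ᵢ (h / ρᵢ)^r` over the blocks of a cell, with `h / ρᵢ` written as the inverse of the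
level. -/
noncomputable def cellDecay (r : ℝ) {m : ℕ} (j : Fin n × Fin d → Fin m) : ℝ :=
  ∑ i, ((level (fun k => j (i, k)) : ℝ) ^ r)⁻¹

theorem cellWeight_nonneg (γ : Fin n → ℝ) {m : ℕ} (j : Fin n × Fin d → Fin m) :
    0 ≤ cellWeight γ j :=
  Finset.prod_nonneg fun i _ => Real.rpow_nonneg (div_nonneg (by positivity) (by positivity)) _

theorem cellDecay_nonneg (r : ℝ) {m : ℕ} (j : Fin n × Fin d → Fin m) : 0 ≤ cellDecay r j :=
  Finset.sum_nonneg fun i _ => by positivity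

theorem exists_integral_majorant_le (hd : 0 < d) {γ : Fin n → ℝ} {s : ℕ}
    (hs : ∀ i, (s : ℝ) < d + γ i) :
    ∃ C : ℝ, 0 ≤ C ∧ ∀ m : ℕ, 0 < m → ∀ j : Fin n × Fin d → Fin m,
      IntegrableOn (majorant γ s) (cell j : Set (Pt n d)) ∧
      ∫ x in (cell j : Set (Pt n d)), majorant γ s x
        ≤ C * (((m : ℝ) ^ (n * d))⁻¹ * cellWeight γ j * (m : ℝ) ^ s) := by
  have he : ∀ i k : Fin n, -(d : ℝ) < γ k - if k = i then (s : ℝ) else 0 := by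
    intro i k
    have h1 := hs k
    have h2 : (0 : ℝ) ≤ s := Nat.cast_nonneg s
    split_ifs <;> linarith
  choose C hC0 hC using fun i k : Fin n => exists_integral_cell_le hd (he i k)
  refine ⟨∑ i, ∏ k, C i k,
    Finset.sum_nonneg fun i _ => Finset.prod_nonneg fun k _ => hC0 i k, fun m hm j => ?_⟩
  have hm' : (0 : ℝ) < m := by exact_mod_cast hm
  have hint : ∀ i : Fin n, IntegrableOn
      (fun x : Pt n d => ∏ k, ‖x k‖ ^ (γ k - if k = i then (s : ℝ) else 0)) (cell j) := fun i =>
    integrableOn_box_prod (cellCorner j) (1 / m)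
      (fun k y => ‖y‖ ^ (γ k - if k = i then (s : ℝ) else 0)) fun k =>
        (hC i k m hm fun k' => j (k, k')).1
  refine ⟨integrable_finsetSum _ fun i _ => hint i, ?_⟩
  simp only [majorant]
  rw [integral_finsetSum _ fun i _ => hint i, Finset.sum_mul]
  refine Finset.sum_le_sum fun i _ => ?_
  have hpos : ∀ k : Fin n, 0 < cellDist fun k' => j (k, k') := fun k => cellDist_pos hm _
  rw [cell, setIntegral_box_prod (cellCorner j) (1 / m)
      (fun k y => ‖y‖ ^ (γ k - if k = i then (s : ℝ) else 0))]
  calc _ ≤ ∏ k, C i k * (((m : ℝ) ^ d)⁻¹ *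
        cellDist (fun k' => j (k, k')) ^ (γ k - if k = i then (s : ℝ) else 0)) :=
        Finset.prod_le_prod (fun k _ => integral_nonneg fun y => by positivity)
          fun k _ => (hC i k m hm fun k' => j (k, k')).2
    _ = (∏ k, C i k) * (((m : ℝ) ^ (n * d))⁻¹ * cellWeight γ j *
        (cellDist (fun k' => j (i, k')) ^ s)⁻¹) := by
        rw [Finset.prod_mul_distrib, Finset.prod_mul_distrib, prod_rpow_sub_ite γ s i hpos,
          Real.rpow_natCast, Finset.prod_const, Finset.card_univ, Fintype.card_fin, inv_pow,
          ← pow_mul, mul_comm d n, cellWeight]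
        ring
    _ ≤ _ := by
        refine mul_le_mul_of_nonneg_left (mul_le_mul_of_nonneg_left ?_
          (mul_nonneg (by positivity) (cellWeight_nonneg γ j)))
          (Finset.prod_nonneg fun k _ => hC0 i k)
        rw [← inv_pow]
        refine pow_le_pow_left₀ (inv_nonneg.2 (hpos i).le) ?_ s
        have h1 : (1 : ℝ) ≤ level fun k' => j (i, k') := by exact_mod_cast one_le_level _
        rw [cellDist, inv_div]
        exact div_le_self hm'.le h1

/-- The sum over all cells factorizes over the blocks; the block that carries the decay is
responsible for the logarithm. -/
theorem exists_sum_cellWeight_mul_cellDecay_le (hd : 0 < d) {γ : Fin n → ℝ} {r : ℝ} (hr : 0 < r)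
    (hrγ : ∀ i, r ≤ d + γ i) :
    ∃ C : ℝ, 0 ≤ C ∧ ∀ m : ℕ, 2 ≤ m →
      ∑ j : Fin n × Fin d → Fin m, ((m : ℝ) ^ (n * d))⁻¹ * (cellWeight γ j * cellDecay r j)
        ≤ C * (Real.log m / (m : ℝ) ^ r) := by
  choose C₁ hC₁0 hC₁ using fun i : Fin n =>
    exists_sum_cellDist_rpow_le hd (γ := γ i) (by linarith [hrγ i])
  choose C₂ hC₂0 hC₂ using fun i : Fin n => exists_sum_cellDist_rpow_mul_le hd (hrγ i)
  refine ⟨∑ i, C₂ i * ∏ k ∈ Finset.univ.erase i, C₁ k, Finset.sum_nonneg fun i _ =>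
    mul_nonneg (hC₂0 i) (Finset.prod_nonneg fun k _ => hC₁0 k), fun m hm => ?_⟩
  have hlog : 0 ≤ Real.log m / (m : ℝ) ^ r :=
    div_nonneg (Real.log_nonneg (by exact_mod_cast (by omega : 1 ≤ m))) (by positivity)
  -- the summand is a sum over `i` of products over the blocks
  set Φ : Fin n → Fin n → (Fin d → Fin m) → ℝ := fun i k q =>
    ((m : ℝ) ^ d)⁻¹ * (cellDist q ^ γ k * if k = i then ((level q : ℝ) ^ r)⁻¹ else 1) with hΦ
  have h1 : ∀ j : Fin n × Fin d → Fin m,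
      ((m : ℝ) ^ (n * d))⁻¹ * (cellWeight γ j * cellDecay r j)
        = ∑ i, ∏ k, Φ i k (fun k' => j (k, k')) := by
    intro j
    rw [cellDecay, Finset.mul_sum, Finset.mul_sum]
    refine Finset.sum_congr rfl fun i _ => ?_
    simp only [hΦ, Finset.prod_mul_distrib, Finset.prod_const, Finset.card_univ,
      Fintype.card_fin, Finset.prod_ite_eq', Finset.mem_univ, if_true, inv_pow, ← pow_mul,
      mul_comm d n, cellWeight]
  have hΦ0 : ∀ i k q, 0 ≤ Φ i k q := by
    intro i k q
    have : 0 ≤ cellDist q := div_nonneg (by positivity) (by positivity)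
    refine mul_nonneg (by positivity) (mul_nonneg (by positivity) ?_)
    split_ifs <;> positivity
  rw [Finset.sum_congr rfl fun j _ => h1 j, Finset.sum_comm, Finset.sum_mul]
  refine Finset.sum_le_sum fun i _ => ?_
  have h2 : ∑ j : Fin n × Fin d → Fin m, ∏ k, Φ i k (fun k' => j (k, k'))
      = ∏ k, ∑ q : Fin d → Fin m, Φ i k q := by
    rw [Finset.prod_univ_sum, Fintype.piFinset_univ]
    exact (Equiv.curry (Fin n) (Fin d) (Fin m)).sum_comp
      fun J : Fin n → Fin d → Fin m => ∏ k, Φ i k (J k)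
  rw [h2, ← Finset.mul_prod_erase _ _ (Finset.mem_univ i)]
  have h3 : ∑ q : Fin d → Fin m, Φ i i q ≤ C₂ i * (Real.log m / (m : ℝ) ^ r) := by
    simp only [hΦ, if_true]
    rw [← Finset.mul_sum]
    exact hC₂ i m hm
  have h4 : ∏ k ∈ Finset.univ.erase i, ∑ q : Fin d → Fin m, Φ i k q
      ≤ ∏ k ∈ Finset.univ.erase i, C₁ k := by
    refine Finset.prod_le_prod (fun k _ => Finset.sum_nonneg fun q _ => hΦ0 i k q) fun k hk => ?_
    simp only [hΦ, if_neg (Finset.ne_of_mem_erase hk), mul_one]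
    rw [← Finset.mul_sum]
    exact hC₁ k m (by omega)
  calc _ ≤ C₂ i * (Real.log m / (m : ℝ) ^ r) * ∏ k ∈ Finset.univ.erase i, C₁ k :=
        mul_le_mul h3 h4 (Finset.prod_nonneg fun k _ => Finset.sum_nonneg fun q _ => hΦ0 i k q)
          (mul_nonneg (hC₂0 i) hlog)
    _ = _ := by ring

end Majorants

/-! ### Error of the trapezoidal rule -/

section ErrorBound

variable {𝕜 : Type*} [RCLike 𝕜] {n d : ℕ}

/-- A function that is smooth where all `xᵢ ≠ 0` and whose derivatives `∂^β g` of order at most `R`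
are bounded by `A ∏ᵢ |xᵢ|^(γᵢ) (∑ᵢ |xᵢ|⁻¹)^|β|` on the cube. -/
structure SingularBound (γ : Fin n → ℝ) (R : ℕ) (A : ℝ) (g : Pt n d → 𝕜) : Prop where
  nonneg : 0 ≤ A
  smooth : ContDiffOn ℝ ∞ g (regularSet n d)
  bound : ∀ β : MultiIndex n d, order β ≤ R → ∀ x ∈ cube n d ∩ regularSet n d,
    ‖multiDeriv β g x‖ ≤ A * ((∏ i, ‖x i‖ ^ γ i) * invSum x ^ order β)

open scoped Classical in
/-- The contribution of the cell with index `j` to the remainder of the expansion. -/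
noncomputable def cellError (g : Pt n d → 𝕜) (xs : Fin n × Fin d → ℝ) (R m : ℕ)
    (j : Fin n × Fin d → Fin m) : 𝕜 :=
  (∫ x in cell j, g x)
    - ((m : 𝕜) ^ (n * d))⁻¹ * (if ∃ i, node xs m j i = 0 then 0 else g (node xs m j))
    - ∑ s ∈ Finset.Ico 1 R, ((m : 𝕜) ^ s)⁻¹ *
      ∑ β ∈ Finset.piAntidiag (Finset.univ : Finset (Fin n × Fin d)) s,
        (emCoeff β xs : 𝕜) * ∫ x in cell j, multiDeriv β g x

variable {γ : Fin n → ℝ} {R : ℕ} {A : ℝ} {g : Pt n d → 𝕜}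

theorem SingularBound.integrableOn_cell (hn : 0 < n) (hd : 0 < d) (hg : SingularBound γ R A g)
    {β : MultiIndex n d} (hβR : order β ≤ R) {m : ℕ} (hm : 0 < m)
    {j : Fin n × Fin d → Fin m} (hint : IntegrableOn (majorant γ (order β)) (cell j)) :
    IntegrableOn (multiDeriv β g) (cell j) ∧
      ‖∫ x in cell j, multiDeriv β g x‖
        ≤ A * (n : ℝ) ^ order β * ∫ x in cell j, majorant γ (order β) x := by
  have hQ : MeasurableSet (cell j : Set (Pt n d)) := (isCompact_box _ _).measurableSet
  have hae : (cell j ∩ regularSet n d : Set (Pt n d)) =ᵐ[volume] cell j :=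
    inter_ae_eq_left_of_ae_eq_univ (eventuallyEq_univ.2 (ae_mem_regularSet hd))
  have hmeas : AEStronglyMeasurable (multiDeriv β g) (volume.restrict (cell j)) := by
    rw [← Measure.restrict_congr_set hae]
    exact ((contDiffOn_multiDeriv isOpen_regularSet hg.smooth β).continuousOn.mono
      Set.inter_subset_right).aestronglyMeasurable (hQ.inter isOpen_regularSet.measurableSet)
  have hle : ∀ᵐ x ∂(volume.restrict (cell j)),
      ‖multiDeriv β g x‖ ≤ A * (n : ℝ) ^ order β * majorant γ (order β) x := by
    filter_upwards [ae_restrict_mem hQ, ae_restrict_of_ae (ae_mem_regularSet hd)] with x h1 h2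
    refine (hg.bound β hβR x ⟨cell_subset_cube hm j h1, h2⟩).trans ?_
    rw [mul_assoc]
    exact mul_le_mul_of_nonneg_left (prod_mul_invSum_pow_le hn γ _ h2) hg.nonneg
  have hint' := hint.const_mul (A * (n : ℝ) ^ order β)
  refine ⟨Integrable.mono' hint' hmeas hle, ?_⟩
  rw [← integral_const_mul]
  exact norm_integral_le_of_norm_le hint' hle

/-- Integrability of the derivatives on the whole cube, which is the only cell of the mesh of
size `1`. -/
theorem SingularBound.integrableOn_cube (hn : 0 < n) (hd : 0 < d) (hg : SingularBound γ R A g)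
    {β : MultiIndex n d} (hβR : order β ≤ R) (hβ : ∀ i, (order β : ℝ) < d + γ i) :
    IntegrableOn (multiDeriv β g) (cube n d) := by
  obtain ⟨C, -, hC⟩ := exists_integral_majorant_le hd hβ
  have h1 := (hg.integrableOn_cell hn hd hβR one_pos
    (hC 1 one_pos (fun _ : Fin n × Fin d => 0)).1).1
  have e : (cell (fun _ : Fin n × Fin d => (0 : Fin 1)) : Set (Pt n d)) = cube n d := by
    rw [cube_eq_box, cell]
    congr 1
    · funext l
      simp [cellCorner]
    · simp
  rwa [e] at h1

theorem exists_norm_integral_cell_le (𝕜 : Type*) [RCLike 𝕜] (hn : 0 < n) (hd : 0 < d)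
    {γ : Fin n → ℝ} {R s : ℕ} (hsR : s ≤ R) (hs : ∀ i, (s : ℝ) < d + γ i) :
    ∃ C : ℝ, 0 ≤ C ∧ ∀ (A : ℝ) (g : Pt n d → 𝕜), SingularBound γ R A g →
      ∀ β : MultiIndex n d, order β = s → ∀ m : ℕ, 0 < m → ∀ j : Fin n × Fin d → Fin m,
      ‖∫ x in cell j, multiDeriv β g x‖
        ≤ C * A * (((m : ℝ) ^ (n * d))⁻¹ * cellWeight γ j * (m : ℝ) ^ s) := by
  obtain ⟨C, hC0, hC⟩ := exists_integral_majorant_le hd hs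
  refine ⟨(n : ℝ) ^ s * C, by positivity, fun A g hg β hβ m hm j => ?_⟩
  subst hβ
  obtain ⟨h1, h2⟩ := hC m hm j
  refine (hg.integrableOn_cell hn hd hsR hm h1).2.trans ?_
  have := hg.nonneg
  calc _ ≤ A * (n : ℝ) ^ order β *
        (C * (((m : ℝ) ^ (n * d))⁻¹ * cellWeight γ j * (m : ℝ) ^ order β)) := by gcongr
    _ = _ := by ring

/-- The value at a node is controlled by the weight of its cell even next to the singular set,
because a nonzero block of a node has norm at least `c / m`. -/
theorem exists_norm_node_le (𝕜 : Type*) [RCLike 𝕜] (hd : 0 < d) (γ : Fin n → ℝ) (R : ℕ)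
    {xs : Fin n × Fin d → ℝ} (hxs : ∀ l, xs l ∈ Set.Icc (0 : ℝ) 1) :
    ∃ C : ℝ, 0 ≤ C ∧ ∀ (A : ℝ) (g : Pt n d → 𝕜), SingularBound γ R A g →
      ∀ m : ℕ, 0 < m → ∀ j : Fin n × Fin d → Fin m, (∀ i, node xs m j i ≠ 0) →
      ‖g (node xs m j)‖ ≤ C * A * cellWeight γ j := by
  obtain ⟨c, hc0, hc⟩ := exists_le_norm_node xs
  set c' : ℝ := min (c / 2) (1 / 6) with hc'
  have hc'0 : 0 < c' := lt_min (by positivity) (by norm_num)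
  refine ⟨∏ i, (c' ^ γ i + (d : ℝ) ^ γ i), Finset.prod_nonneg fun i _ => by positivity,
    fun A g hg m hm j hne => ?_⟩
  have hm' : (0 : ℝ) < m := by exact_mod_cast hm
  have hcell := node_mem_cell hxs hm j
  have h1 := hg.bound 0 (by simp [order]) (node xs m j) ⟨cell_subset_cube hm j hcell, hne⟩
  have h0 : order (0 : MultiIndex n d) = 0 := by simp [order]
  rw [multiDeriv_zero, h0, pow_zero, mul_one] at h1
  have h2 : ∏ i, ‖node xs m j i‖ ^ γ i
      ≤ ∏ i, (c' ^ γ i + (d : ℝ) ^ γ i) * cellDist (fun k => j (i, k)) ^ γ i := by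
    refine Finset.prod_le_prod (fun i _ => by positivity) fun i _ => ?_
    have hρ := cellDist_pos hm fun k => j (i, k)
    refine rpow_le_of_le_of_le _ hc'0 hρ ?_
      (norm_le_cellDist hm _ (mem_blockBox_of_mem_cell hcell i))
    rcases Nat.lt_or_ge (level fun k => j (i, k)) 3 with hq | hq
    · refine le_trans ?_ (hc m hm j i (hne i))
      have h3 : (level (fun k => j (i, k)) : ℝ) ≤ 2 := by
        exact_mod_cast (by omega : level (fun k => j (i, k)) ≤ 2)
      calc c' * cellDist (fun k => j (i, k)) ≤ c / 2 * (2 / m) := by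
            rw [cellDist]
            gcongr
            exact min_le_left _ _
        _ = c / m := by ring
    · have h3 := cellDist_le_norm hd hm _ hq (mem_blockBox_of_mem_cell hcell i)
      have h4 := mul_le_mul_of_nonneg_right (min_le_right (c / 2) (1 / 6 : ℝ)) hρ.le
      rw [← hc'] at h4
      linarith
  rw [Finset.prod_mul_distrib] at h2
  calc _ ≤ A * ∏ i, ‖node xs m j i‖ ^ γ i := h1
    _ ≤ A * _ := mul_le_mul_of_nonneg_left h2 hg.nonneg
    _ = _ := by rw [cellWeight]; ring

theorem mem_regularSet_of_mem_cell (hd : 0 < d) {m : ℕ} (hm : 0 < m)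
    {j : Fin n × Fin d → Fin m} (hj : ∀ i, 3 ≤ level fun k => j (i, k)) {x : Pt n d}
    (hx : x ∈ cell j) : x ∈ regularSet n d := by
  intro i
  have h1 := cellDist_le_norm hd hm _ (hj i) (mem_blockBox_of_mem_cell hx i)
  have h2 := cellDist_pos hm fun k => j (i, k)
  exact norm_pos_iff.1 (by linarith)

/-- In a cell away from the singular set, the error is the remainder of the Euler-Maclaurin formula
for a single node. -/
theorem cellError_eq_cellRemainder (hd : 0 < d) (hR : 0 < R) {xs : Fin n × Fin d → ℝ}
    (hxs : ∀ l, xs l ∈ Set.Icc (0 : ℝ) 1) {m : ℕ} (hm : 0 < m) {j : Fin n × Fin d → Fin m}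
    (hj : ∀ i, 3 ≤ level fun k => j (i, k)) (g : Pt n d → 𝕜) :
    cellError g xs R m j
      = -((((m : ℝ) ^ (n * d))⁻¹) • cellRemainder R (cellCorner j) (1 / m) g (node xs m j)) := by
  have hm' : (m : ℝ) ≠ 0 := by exact_mod_cast hm.ne'
  have hnode : ¬ ∃ i, node xs m j i = 0 := by
    push Not
    exact mem_regularSet_of_mem_cell hd hm hj (node_mem_cell hxs hm j)
  have hcast : ∀ k : ℕ, (((m : 𝕜) ^ k)⁻¹ : 𝕜) = ((((m : ℝ) ^ k)⁻¹ : ℝ) : 𝕜) := fun k => by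
    push_cast; rfl
  rw [cellError, if_neg hnode, cellRemainder, Finset.range_eq_Ico,
    Finset.sum_eq_sum_Ico_succ_bot hR, relCoord_node xs hm]
  have h0 : ∑ β ∈ Finset.piAntidiag (Finset.univ : Finset (Fin n × Fin d)) 0, bernWeight β xs •
      (((1 / m : ℝ)) ^ 0 * ((1 / m : ℝ) ^ (n * d))⁻¹) •
        ∫ y in box (cellCorner j) (1 / m), multiDeriv β g y
      = ((m : ℝ) ^ (n * d)) • ∫ y in cell j, g y := by
    rw [Finset.sum_eq_single 0]
    · simp [bernWeight_zero, multiDeriv_zero, cell]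
    · intro β hβ hβ0
      exact absurd (eq_zero_of_order_eq_zero (mem_piAntidiag_univ.1 hβ)) hβ0
    · intro h
      exact absurd (mem_piAntidiag_univ.2 (by simp [order])) h
  rw [h0, smul_sub, smul_add, smul_smul, inv_mul_cancel₀ (pow_ne_zero _ hm'), one_smul,
    Finset.smul_sum]
  have h1 : ∀ s ∈ Finset.Ico (0 + 1) R, (((m : ℝ) ^ (n * d))⁻¹) •
      ∑ β ∈ Finset.piAntidiag (Finset.univ : Finset (Fin n × Fin d)) s, bernWeight β xs •
        (((1 / m : ℝ)) ^ s * ((1 / m : ℝ) ^ (n * d))⁻¹) •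
          ∫ y in box (cellCorner j) (1 / m), multiDeriv β g y
      = -(((m : 𝕜) ^ s)⁻¹ *
        ∑ β ∈ Finset.piAntidiag (Finset.univ : Finset (Fin n × Fin d)) s,
          (emCoeff β xs : 𝕜) * ∫ x in cell j, multiDeriv β g x) := by
    intro s _
    rw [Finset.smul_sum, Finset.mul_sum, ← Finset.sum_neg_distrib]
    refine Finset.sum_congr rfl fun β _ => ?_
    rw [emCoeff_eq_neg_bernWeight, hcast, smul_smul, smul_smul, RCLike.real_smul_eq_coe_mul, cell]
    have e : ((m : ℝ) ^ (n * d))⁻¹ * bernWeight β xs *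
        ((1 / m : ℝ) ^ s * ((1 / m : ℝ) ^ (n * d))⁻¹) = ((m : ℝ) ^ s)⁻¹ * bernWeight β xs := by
      rw [one_div, inv_pow, inv_pow, inv_inv]
      field_simp
    rw [e]
    push_cast
    ring
  rw [Finset.sum_congr rfl h1, Finset.sum_neg_distrib, hcast, RCLike.real_smul_eq_coe_mul]
  simp only [zero_add]
  ring

/-- The error of a cell, close to the singular set or not, is bounded by its weight times its
decay. -/
theorem exists_norm_cellError_le (𝕜 : Type*) [RCLike 𝕜] (hn : 0 < n) (hd : 0 < d)
    {γ : Fin n → ℝ} {r : ℝ} (hr : 0 < r) (hrγ : ∀ i, r ≤ d + γ i)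
    {xs : Fin n × Fin d → ℝ} (hxs : ∀ l, xs l ∈ Set.Icc (0 : ℝ) 1) :
    ∃ C : ℝ, 0 ≤ C ∧ ∀ (A : ℝ) (g : Pt n d → 𝕜), SingularBound γ ⌈r⌉₊ A g →
      ∀ m : ℕ, 0 < m → ∀ j : Fin n × Fin d → Fin m,
      ‖cellError g xs ⌈r⌉₊ m j‖
        ≤ C * A * (((m : ℝ) ^ (n * d))⁻¹ * (cellWeight γ j * cellDecay r j)) := by
  set R := ⌈r⌉₊ with hRdef
  have hR : 0 < R := Nat.ceil_pos.2 hr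
  have hrR : r ≤ R := Nat.le_ceil r
  have hsr : ∀ s : ℕ, s < R → ∀ i, (s : ℝ) < d + γ i := fun s hs i =>
    (Nat.lt_ceil.1 hs).trans_le (hrγ i)
  have hCs : ∀ s : ℕ, ∃ C : ℝ, 0 ≤ C ∧ (s < R → ∀ (A : ℝ) (g : Pt n d → 𝕜),
      SingularBound γ R A g → ∀ β : MultiIndex n d, order β = s → ∀ m : ℕ, 0 < m →
      ∀ j : Fin n × Fin d → Fin m, ‖∫ x in cell j, multiDeriv β g x‖
        ≤ C * A * (((m : ℝ) ^ (n * d))⁻¹ * cellWeight γ j * (m : ℝ) ^ s)) := by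
    intro s
    by_cases hs : s < R
    · obtain ⟨C, hC0, hC⟩ := exists_norm_integral_cell_le 𝕜 hn hd hs.le (hsr s hs)
      exact ⟨C, hC0, fun _ => hC⟩
    · exact ⟨0, le_rfl, fun h => absurd h hs⟩
  choose Ci hCi0 hCi using hCs
  obtain ⟨Cn, hCn0, hCn⟩ := exists_norm_node_le 𝕜 hd γ R hxs
  set B : ℝ := ∑ s ∈ Finset.Ico 1 R,
    ∑ β ∈ Finset.piAntidiag (Finset.univ : Finset (Fin n × Fin d)) s, |emCoeff β xs| * Ci s with hB
  have hB0 : 0 ≤ B := Finset.sum_nonneg fun s _ => Finset.sum_nonneg fun β _ =>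
    mul_nonneg (abs_nonneg _) (hCi0 s)
  set Cnear : ℝ := (Ci 0 + Cn + B) * 2 ^ r with hCnear
  set Cfar : ℝ := ((n * d : ℕ) : ℝ) ^ R *
    ((∏ i, ((1 / 6) ^ γ i + (d : ℝ) ^ γ i)) * (6 ^ R * (n : ℝ) ^ R)) with hCfar
  have hCnear0 : 0 ≤ Cnear := mul_nonneg (by linarith [hCi0 0]) (by positivity)
  have hCfar0 : 0 ≤ Cfar := mul_nonneg (by positivity)
    (mul_nonneg (Finset.prod_nonneg fun i _ => by positivity) (by positivity))
  refine ⟨Cnear + Cfar, by positivity, fun A g hg m hm j => ?_⟩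
  have hm' : (0 : ℝ) < m := by exact_mod_cast hm
  have hA := hg.nonneg
  have hW := cellWeight_nonneg γ j
  have hD := cellDecay_nonneg r j
  have hN : (0 : ℝ) ≤ ((m : ℝ) ^ (n * d))⁻¹ := by positivity
  have hX : 0 ≤ A * (((m : ℝ) ^ (n * d))⁻¹ * (cellWeight γ j * cellDecay r j)) := by positivity
  by_cases hj : ∀ i, 3 ≤ level fun k => j (i, k)
  · -- cells away from the singular set
    rw [cellError_eq_cellRemainder hd hR hxs hm hj g, norm_neg, norm_smul,
      Real.norm_of_nonneg hN]
    have hQ : box (cellCorner j) (1 / m) ⊆ regularSet n d := fun x hx =>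
      mem_regularSet_of_mem_cell hd hm hj hx
    have hρ : ∀ i, 0 < cellDist fun k => j (i, k) := fun i => cellDist_pos hm _
    have hsup : ∀ β : MultiIndex n d, order β = R → ∀ x ∈ box (cellCorner j) (1 / m),
        ‖multiDeriv β g x‖ ≤ A * (((∏ i, ((1 / 6) ^ γ i + (d : ℝ) ^ γ i)) * cellWeight γ j) *
          (∑ i, 6 * (cellDist fun k => j (i, k))⁻¹) ^ R) := by
      intro β hβ x hx
      have hlow : ∀ i, cellDist (fun k => j (i, k)) / 6 ≤ ‖x i‖ := fun i =>
        cellDist_le_norm hd hm _ (hj i) (mem_blockBox_of_mem_cell hx i)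
      refine (hg.bound β hβ.le x ⟨cell_subset_cube hm j hx, hQ hx⟩).trans ?_
      rw [hβ]
      refine mul_le_mul_of_nonneg_left (mul_le_mul ?_ ?_ (pow_nonneg (invSum_nonneg x) R)
        (mul_nonneg (Finset.prod_nonneg fun i _ => by positivity) hW)) hA
      · rw [cellWeight, ← Finset.prod_mul_distrib]
        refine Finset.prod_le_prod (fun i _ => by positivity) fun i _ =>
          rpow_le_of_le_of_le _ (by norm_num) (hρ i) ?_
            (norm_le_cellDist hm _ (mem_blockBox_of_mem_cell hx i))
        linarith [hlow i]
      · refine pow_le_pow_left₀ (invSum_nonneg x) (Finset.sum_le_sum fun i _ => ?_) R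
        have h1 := inv_anti₀ (by linarith [hρ i]) (hlow i)
        rwa [inv_div, div_eq_mul_inv] at h1
    have h1 := norm_cellRemainder_le isOpen_regularSet R (by positivity : (0 : ℝ) < 1 / m) hQ g
      hg.smooth hsup (node xs m j) (node_mem_cell hxs hm j)
    have h2 : (∑ i, 6 * (cellDist fun k => j (i, k))⁻¹) ^ R
        ≤ 6 ^ R * (n : ℝ) ^ R * ((m : ℝ) ^ R * cellDecay r j) := by
      rw [← Finset.mul_sum, mul_pow, mul_assoc]
      refine mul_le_mul_of_nonneg_left ?_ (by positivity)
      have h3 := sum_pow_le (b := fun i => (cellDist fun k => j (i, k))⁻¹)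
        (fun i => (inv_pos.2 (hρ i)).le) ⟨⟨0, hn⟩⟩ R
      rw [Fintype.card_fin] at h3
      refine h3.trans (mul_le_mul_of_nonneg_left ?_ (by positivity))
      rw [cellDecay, Finset.mul_sum]
      refine Finset.sum_le_sum fun i _ => ?_
      have hl : (1 : ℝ) ≤ level fun k => j (i, k) := by exact_mod_cast one_le_level _
      rw [cellDist, inv_div, div_pow, div_eq_mul_inv]
      refine mul_le_mul_of_nonneg_left (inv_anti₀ (by positivity) ?_) (by positivity)
      rw [← Real.rpow_natCast]
      exact Real.rpow_le_rpow_of_exponent_le hl hrR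
    calc _ ≤ ((m : ℝ) ^ (n * d))⁻¹ * (((n * d : ℕ) * (1 / m : ℝ)) ^ R *
          (A * (((∏ i, ((1 / 6) ^ γ i + (d : ℝ) ^ γ i)) * cellWeight γ j) *
            (6 ^ R * (n : ℝ) ^ R * ((m : ℝ) ^ R * cellDecay r j))))) := by
          refine mul_le_mul_of_nonneg_left (h1.trans (mul_le_mul_of_nonneg_left
            (mul_le_mul_of_nonneg_left (mul_le_mul_of_nonneg_left h2 ?_) hA) (by positivity))) hN
          exact mul_nonneg (Finset.prod_nonneg fun i _ => by positivity) hW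
      _ = Cfar * (A * (((m : ℝ) ^ (n * d))⁻¹ * (cellWeight γ j * cellDecay r j))) := by
          rw [mul_pow, one_div, inv_pow, hCfar]
          field_simp
      _ ≤ (Cnear + Cfar) * (A * (((m : ℝ) ^ (n * d))⁻¹ * (cellWeight γ j * cellDecay r j))) :=
          mul_le_mul_of_nonneg_right (by linarith) hX
      _ = _ := by ring
  · -- cells close to the singular set: every term is small by itself
    push Not at hj
    obtain ⟨i, hi⟩ := hj
    have hdec : 1 ≤ 2 ^ r * cellDecay r j := by
      have h1 : ((level (fun k => j (i, k)) : ℝ) ^ r)⁻¹ ≤ cellDecay r j :=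
        Finset.single_le_sum (f := fun i => ((level (fun k => j (i, k)) : ℝ) ^ r)⁻¹)
          (fun i _ => by positivity) (Finset.mem_univ i)
      have h2 : (level (fun k => j (i, k)) : ℝ) ≤ 2 := by
        exact_mod_cast (by omega : level (fun k => j (i, k)) ≤ 2)
      have h3 : (0 : ℝ) < level fun k => j (i, k) := by exact_mod_cast one_le_level _
      have h4 : ((2 : ℝ) ^ r)⁻¹ ≤ ((level (fun k => j (i, k)) : ℝ) ^ r)⁻¹ :=
        inv_anti₀ (by positivity) (Real.rpow_le_rpow h3.le h2 hr.le)
      have h5 : (2 : ℝ) ^ r * ((2 : ℝ) ^ r)⁻¹ = 1 := mul_inv_cancel₀ (by positivity)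
      rw [← h5]
      exact mul_le_mul_of_nonneg_left (h4.trans h1) (by positivity)
    set Y : ℝ := A * (((m : ℝ) ^ (n * d))⁻¹ * cellWeight γ j) with hY
    have hY0 : 0 ≤ Y := by positivity
    have t1 : ‖∫ x in cell j, g x‖ ≤ Ci 0 * Y := by
      have h1 := hCi 0 hR A g hg 0 (by simp [order]) m hm j
      rw [multiDeriv_zero, pow_zero, mul_one] at h1
      rw [hY, ← mul_assoc]
      exact h1
    have t2 : ‖((m : 𝕜) ^ (n * d))⁻¹ *
        (if ∃ i, node xs m j i = 0 then 0 else g (node xs m j))‖ ≤ Cn * Y := by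
      split_ifs with h0
      · rw [mul_zero, norm_zero]; positivity
      · push Not at h0
        rw [norm_mul, norm_inv, norm_pow, RCLike.norm_natCast]
        calc _ ≤ ((m : ℝ) ^ (n * d))⁻¹ * (Cn * A * cellWeight γ j) :=
              mul_le_mul_of_nonneg_left (hCn A g hg m hm j h0) hN
          _ = _ := by rw [hY]; ring
    have t3 : ‖∑ s ∈ Finset.Ico 1 R, ((m : 𝕜) ^ s)⁻¹ *
        ∑ β ∈ Finset.piAntidiag (Finset.univ : Finset (Fin n × Fin d)) s,
          (emCoeff β xs : 𝕜) * ∫ x in cell j, multiDeriv β g x‖ ≤ B * Y := by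
      rw [hB, Finset.sum_mul]
      refine norm_sum_le_of_le _ fun s hs => ?_
      rw [norm_mul, norm_inv, norm_pow, RCLike.norm_natCast, Finset.sum_mul]
      rw [inv_mul_le_iff₀ (by positivity), Finset.mul_sum]
      refine norm_sum_le_of_le _ fun β hβ => ?_
      rw [norm_mul, RCLike.norm_ofReal]
      have h1 := hCi s (Finset.mem_Ico.1 hs).2 A g hg β (mem_piAntidiag_univ.1 hβ) m hm j
      calc _ ≤ |emCoeff β xs| *
            (Ci s * A * (((m : ℝ) ^ (n * d))⁻¹ * cellWeight γ j * (m : ℝ) ^ s)) :=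
            mul_le_mul_of_nonneg_left h1 (abs_nonneg _)
        _ = _ := by rw [hY]; ring
    calc ‖cellError g xs R m j‖ ≤ Ci 0 * Y + Cn * Y + B * Y := by
          rw [cellError]
          exact (norm_sub_le _ _).trans (add_le_add ((norm_sub_le _ _).trans (add_le_add t1 t2)) t3)
      _ = (Ci 0 + Cn + B) * Y * 1 := by ring
      _ ≤ (Ci 0 + Cn + B) * Y * (2 ^ r * cellDecay r j) :=
          mul_le_mul_of_nonneg_left hdec (mul_nonneg (by linarith [hCi0 0]) hY0)
      _ = Cnear * (A * (((m : ℝ) ^ (n * d))⁻¹ * (cellWeight γ j * cellDecay r j))) := by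
          rw [hCnear, hY]; ring
      _ ≤ (Cnear + Cfar) * (A * (((m : ℝ) ^ (n * d))⁻¹ * (cellWeight γ j * cellDecay r j))) :=
          mul_le_mul_of_nonneg_right (by linarith) hX
      _ = _ := by ring

theorem quadError_sub_emSum_eq_sum {r : ℝ} (hr : 0 < r) {g : Pt n d → 𝕜}
    (xs : Fin n × Fin d → ℝ)
    (hg : ∀ β : MultiIndex n d, (order β : ℝ) < r → IntegrableOn (multiDeriv β g) (cube n d))
    {m : ℕ} (hm : 0 < m) :
    quadError g xs m - emSum g xs r m
      = ∑ j : Fin n × Fin d → Fin m, cellError g xs ⌈r⌉₊ m j := by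
  have h0 : IntegrableOn g (cube n d) := by
    simpa only [multiDeriv_zero] using hg 0 (by simpa [order] using hr)
  simp only [cellError]
  rw [quadError, trapezoidal, emSum, Finset.sum_sub_distrib, Finset.sum_sub_distrib,
    setIntegral_cube_eq_sum hm h0, Finset.mul_sum]
  congr 1
  rw [Finset.sum_comm]
  refine Finset.sum_congr rfl fun s hs => ?_
  rw [← Finset.mul_sum, Finset.sum_comm]
  congr 1
  refine Finset.sum_congr rfl fun β hβ => ?_
  rw [← Finset.mul_sum, setIntegral_cube_eq_sum hm (hg β ?_)]
  rw [mem_piAntidiag_univ.1 hβ]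
  exact Nat.lt_ceil.1 (Finset.mem_Ico.1 hs).2

theorem exists_quadError_sub_emSum_le (𝕜 : Type*) [RCLike 𝕜] (hn : 0 < n) (hd : 0 < d)
    {γ : Fin n → ℝ} {r : ℝ} (hr : 0 < r) (hrγ : ∀ i, r ≤ d + γ i)
    {xs : Fin n × Fin d → ℝ} (hxs : ∀ l, xs l ∈ Set.Icc (0 : ℝ) 1) :
    ∃ C : ℝ, 0 ≤ C ∧ ∀ (A : ℝ) (g : Pt n d → 𝕜), SingularBound γ ⌈r⌉₊ A g →
      (∀ β : MultiIndex n d, (order β : ℝ) < r → IntegrableOn (multiDeriv β g) (cube n d)) ∧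
      ∀ m : ℕ, 2 ≤ m →
        ‖quadError g xs m - emSum g xs r m‖ ≤ C * A * (Real.log m / (m : ℝ) ^ r) := by
  obtain ⟨C₁, hC₁0, hC₁⟩ := exists_norm_cellError_le 𝕜 hn hd hr hrγ hxs
  obtain ⟨C₂, hC₂0, hC₂⟩ := exists_sum_cellWeight_mul_cellDecay_le (d := d) hd hr hrγ
  refine ⟨C₁ * C₂, by positivity, fun A g hg => ?_⟩
  have hint : ∀ β : MultiIndex n d, (order β : ℝ) < r →
      IntegrableOn (multiDeriv β g) (cube n d) := fun β hβ =>
    hg.integrableOn_cube hn hd (Nat.lt_ceil.2 hβ).le fun i => hβ.trans_le (hrγ i)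
  refine ⟨hint, fun m hm => ?_⟩
  rw [quadError_sub_emSum_eq_sum hr xs hint (by omega)]
  have hA := hg.nonneg
  refine (norm_sum_le_of_le _ fun j _ => hC₁ A g hg m (by omega) j).trans ?_
  rw [← Finset.mul_sum]
  calc _ ≤ C₁ * A * (C₂ * (Real.log m / (m : ℝ) ^ r)) :=
        mul_le_mul_of_nonneg_left (hC₂ m hm) (by positivity)
    _ = _ := by ring

theorem rate_le (a : Fin n → ℕ) (p : Fin n → ℝ) (i : Fin n) :
    rate d a p ≤ d + gam a p i := by
  have := ciInf_le (Set.finite_range (gam a p)).bddBelow i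
  rw [rate]; linarith

theorem rate_pos (hn : 0 < n) {a : Fin n → ℕ} {p : Fin n → ℝ}
    (hγ : ∀ i, -(d : ℝ) < gam a p i) : 0 < rate d a p := by
  have : Nonempty (Fin n) := ⟨⟨0, hn⟩⟩
  obtain ⟨i, hi⟩ := exists_eq_ciInf_of_finite (f := gam a p)
  have := hγ i
  rw [rate, ← hi]; linarith

end ErrorBound

end FracEM

theorem mainTheorem1 {𝕜 : Type*} [RCLike 𝕜] {n d : ℕ} (hn : 0 < n) (hd : 0 < d)
    (M : Matrix (Fin d) (Fin d) ℝ) (hM : M.PosDef)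
    (a : Fin n → ℕ) (p : Fin n → ℝ) (hγ : ∀ i, -(d : ℝ) < FracEM.gam a p i)
    (xs : Fin n × Fin d → ℝ) (hxs : ∀ l, xs l ∈ Set.Icc (0 : ℝ) 1) :
    ∃ C : ℝ → ℝ, ∀ f : Fin n → FracEM.Pt n d → 𝕜, FracEM.Admissible a f →
      (∀ β : FracEM.MultiIndex n d, (FracEM.order β : ℝ) < FracEM.rate d a p →
        IntegrableOn (FracEM.multiDeriv β (FracEM.fractionalForm M p f)) (FracEM.cube n d)) ∧
      ((fun m : ℕ =>
          FracEM.quadError (FracEM.fractionalForm M p f) xs m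
            - FracEM.emSum (FracEM.fractionalForm M p f) xs (FracEM.rate d a p) m)
        =O[atTop] fun m : ℕ => Real.log m / (m : ℝ) ^ FracEM.rate d a p) ∧
      (∀ K : ℝ, FracEM.DerivBound a (FracEM.rate d a p) f K → ∀ m : ℕ, 2 ≤ m →
        ‖FracEM.quadError (FracEM.fractionalForm M p f) xs m
            - FracEM.emSum (FracEM.fractionalForm M p f) xs (FracEM.rate d a p) m‖
          ≤ C K * (Real.log m / (m : ℝ) ^ FracEM.rate d a p)) := by
  obtain ⟨C, -, hC⟩ := FracEM.exists_quadError_sub_emSum_le 𝕜 hn hd (FracEM.rate_pos hn hγ)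
    (FracEM.rate_le a p) hxs
  choose A hA0 hA using fun K : ℝ => FracEM.exists_multiDeriv_fractionalForm_le (𝕜 := 𝕜) hM a p
    ⌈FracEM.rate d a p⌉₊ (max K 0 * (d : ℝ) ^ ⌈FracEM.rate d a p⌉₊)
  refine ⟨fun K => C * A K, fun f hf => ?_⟩
  have hsing : ∀ K : ℝ, FracEM.DerivBound a (FracEM.rate d a p) f K →
      FracEM.SingularBound (FracEM.gam a p) ⌈FracEM.rate d a p⌉₊ (A K)
        (FracEM.fractionalForm M p f) := fun K hK =>
    ⟨hA0 K, FracEM.contDiffOn_fractionalForm hM p hf.smooth,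
      hA K f hf.smooth fun i => hK.symbolBound hd hf.smooth i⟩
  obtain ⟨K₀, hK₀⟩ := hf.exists_derivBound (FracEM.rate d a p)
  refine ⟨(hC _ _ (hsing K₀ hK₀)).1, ?_, fun K hK => (hC _ _ (hsing K hK)).2⟩
  refine IsBigO.of_bound (C * A K₀) ?_
  filter_upwards [eventually_ge_atTop 2] with m hm
  have hlog : 0 ≤ Real.log m / (m : ℝ) ^ FracEM.rate d a p :=
    div_nonneg (Real.log_nonneg (by exact_mod_cast (by omega : 1 ≤ m))) (by positivity)
  rw [Real.norm_of_nonneg hlog]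
  exact (hC _ _ (hsing K₀ hK₀)).2 m hm
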